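/- Let $\Lambda_j=[-j,j]^4\cap\mathbb Z^4$, viewed as a cell complex with its oriented $k$-cells, and let $d$ be the discrete exterior derivative, $d\omega(w)=\sum_{v\in\partial w}\omega(v)$. The Villain coupling on $\Lambda_j$ at inverse temperature $\beta>0$ is the random pair $(\theta,m)$, where $\theta$ is a $1$-form on $\Lambda_j$ with values in $[-\pi,\pi)$ and $m$ is an integer-valued $2$-form on $\Lambda_j$, with law proportional to $$\exp\Big(-\frac\beta2\sum_{f}\big(d\theta(f)+2\pi m(f)\big)^2\Big)\,d\theta ,$$ the sum being over the non-oriented $2$-cells $f$ of $\Lambda_j$; with free boundary condition there is no further constraint, and with Dirichlet (zero) boundary condition $\theta$ and $m$ are required to vanish on the cells contained in the boundary of $[-j,j]^4$. For $a\in\mathbb R$ and $b>0$, let $\operatorname{Var}^{IG}(a,b)$ be the variance of the $\mathbb Z$-valued random variable $X$ with $\mathbb P[X=k]\propto e^{-\frac b2(k-a)^2}$, and for an oriented $2$-cell $f$ of $\Lambda_j$ put $$\tilde M(\beta,f)=\tilde M_j(\beta,f):=\mathbb E\Big[\operatorname{Var}^{IG}\Big(-\frac{d\theta(f)}{2\pi},(2\pi)^2\beta\Big)\Big].$$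 For every $\delta>0$ there exists $\beta_0<\infty$ such that for every $\beta\ge\beta_0$ there exists $L_0\in\mathbb N$ such that for every $j\ge L_0$, for either the free or the Dirichlet boundary condition on $\Lambda_j$, and for every $2$-cell $f$ of $\Lambda_j$ at distance at least $L_0$ from the boundary, $$\tilde M_j(\beta,f)\ \ge\ e^{-\pi^2\beta(1+\delta)} .$$ Moreover, for either boundary condition and every $2$-cell $f$ of $\mathbb Z^4$, $$\liminf_{\beta\to\infty}\ \liminf_{j\to\infty}\ \frac1\beta\log\tilde M_j(\beta,f)\ \ge\ -\pi^2 .$$ -/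

import Mathlib

open MeasureTheory ProbabilityTheory Filter

noncomputable section

namespace VillainGauge

/-! ### Normalized measures and integer-valued Gaussian variables -/

/-- The probability measure proportional to `μ` (when `μ` has positive finite mass). -/
def normalize {α : Type*} [MeasurableSpace α] (μ : Measure α) : Measure α :=
  (μ Set.univ)⁻¹ • μ

/-- The law of an integer-valued Gaussian variable with parameters `(a, β)`:
`P(X = k) ∝ exp (-(β / 2) * (k - a) ^ 2)` for `k : ℤ`. -/
def igLaw (a β : ℝ) : Measure ℤ :=
  normalize ((Measure.count : Measure ℤ).withDensity
    fun k => ENNReal.ofReal (Real.exp (-(β / 2) * ((k : ℝ) - a) ^ 2)))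

/-- The variance of an integer-valued Gaussian variable with parameters `(a, β)`. -/
def varIG (a β : ℝ) : ℝ :=
  variance (fun k : ℤ => (k : ℝ)) (igLaw a β)

/-! ### Cells of `ℤⁿ` -/

/-- A positively oriented `k`-cell `(v₁ ∧ ⋯ ∧ v_k)_x` of `ℤⁿ`: `x` is its base point and
`v_l` is the canonical basis vector of index `dir l`, the indices being increasing.
As a set it is `∏ i, [x i, x i + 1]` over the directions `i` of the cell times
`∏ i, {x i}` over the others. -/
@[ext]
structure Cell (n k : ℕ) where
  base : Fin n → ℤ
  dir : Fin k ↪o Fin n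

/-- An oriented `k`-cell: a positively oriented one together with a sign. -/
structure OrientedCell (n k : ℕ) where
  cell : Cell n k
  sign : ℤˣ

open Classical in
/-- The cell, as a closed set, is contained in the cube `[-r, r]ⁿ`. -/
def Cell.InBox {n k : ℕ} (w : Cell n k) (r : ℤ) : Prop :=
  ∀ i, -r ≤ w.base i ∧ w.base i + (if i ∈ Set.range w.dir then 1 else 0) ≤ r

/-- A cell of `[-j, j]ⁿ` is contained in the boundary of the cube: one of the coordinates that are
constant on the cell is equal to `j` or `-j`. -/
def Cell.OnBoundary {n k : ℕ} (w : Cell n k) (j : ℕ) : Prop :=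
  ∃ i, i ∉ Set.range w.dir ∧ (w.base i = j ∨ w.base i = -j)

/-- The cell is contained in the box `Λ_j = [-j, j]ⁿ` and is at distance at least `L` from the
boundary of the box. (A point `v` of the box is at distance `min i, (j - |v i|)` from the
boundary, be it for the Euclidean, the supremum or the graph distance.) -/
def Cell.FarFromBoundary {n k : ℕ} (w : Cell n k) (j L : ℕ) : Prop :=
  w.InBox ((j : ℤ) - L)

/-- The face of a cell obtained by omitting its direction of index `l`; its base point is
`x + ε v_l`. -/
def Cell.face {n k : ℕ} (w : Cell n (k + 1)) (l : Fin (k + 1)) (ε : Fin 2) : Cell n k where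
  base := w.base + (if ε = 1 then Pi.single (w.dir l) 1 else 0)
  dir := (Fin.succAboveOrderEmb l).trans w.dir

/-- The discrete exterior derivative of a form, given by its values on positively oriented cells:
the sum of `(-1) ^ (ε + l) ω((v₁ ∧ ⋯ ∧ v̂_l ∧ ⋯ ∧ v_k)_{x + ε v_l})` over `ε ∈ {0, 1}` and
`1 ≤ l ≤ k` (the indices of `Fin` start at `0`). -/
def extDeriv {n k : ℕ} (ω : Cell n k → ℝ) (w : Cell n (k + 1)) : ℝ :=
  ∑ ε : Fin 2, ∑ l : Fin (k + 1), (-1) ^ ((ε : ℕ) + ((l : ℕ) + 1)) * ω (w.face l ε)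

/-- The value of a form on an oriented cell: `ω (w⁻¹) = - ω w`. -/
def orientedValue {n k : ℕ} (ω : Cell n k → ℝ) (w : OrientedCell n k) : ℝ :=
  ((w.sign : ℤ) : ℝ) * ω w.cell

/-! ### Forms on the box `Λ_j = [-j, j]ⁿ`, with free or zero boundary condition -/

/-- The boundary condition. -/
inductive BC
  | free
  | zero

/-- The cells of `Λ_j` on which a form with the given boundary condition may be nonzero:
all cells of `Λ_j` for the free one, the cells that are not contained in the boundary for the
zero one. -/
def BoxCell (n k : ℕ) (bc : BC) (j : ℕ) : Type :=
  {w : Cell n k // w.InBox j ∧ (bc = BC.zero → ¬ w.OnBoundary j)}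

instance (n k : ℕ) (bc : BC) (j : ℕ) : Finite (BoxCell n k bc j) := by
  have hfin : Finite (Fin k ↪o Fin n) := DFunLike.finite _
  refine Finite.of_injective
    (β := (Fin n → Set.Icc (-(j : ℤ)) j) × (Fin k ↪o Fin n))
    (fun w => (fun i => ⟨w.1.base i, (w.2.1 i).1, ?_⟩, w.1.dir)) ?_
  · have h := (w.2.1 i).2
    split_ifs at h <;> linarith
  · intro v w h
    simp only [Prod.mk.injEq, funext_iff] at h
    exact Subtype.ext (Cell.ext (funext fun i => congrArg Subtype.val (h.1 i)) h.2)

instance (n k : ℕ) (bc : BC) (j : ℕ) : Fintype (BoxCell n k bc j) :=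
  Fintype.ofFinite _

/-- The form on the cells of `ℤⁿ` that has the given values on the cells of `BoxCell` and vanishes
on the other ones. -/
def extendZero {n k : ℕ} {bc : BC} {j : ℕ} {R : Type*} [Zero R] (ω : BoxCell n k bc j → R)
    (w : Cell n k) : R :=
  open Classical in if h : w.InBox j ∧ (bc = BC.zero → ¬ w.OnBoundary j) then ω ⟨w, h⟩ else 0

/-! ### The Villain `U(1)`-lattice gauge coupling on `Λ_j = [-j, j]⁴` -/

/-- The pairs `(θ, m)` of a real `1`-form and an integer-valued `2`-form on `Λ_j`, with the given
boundary condition. -/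
abbrev Config (bc : BC) (j : ℕ) : Type :=
  (BoxCell 4 1 bc j → ℝ) × (BoxCell 4 2 bc j → ℤ)

/-- The `2`-form `dθ`. -/
def dTheta {bc : BC} {j : ℕ} (p : Config bc j) : Cell 4 2 → ℝ :=
  extDeriv (extendZero p.1)

/-- `⟨dθ + 2π m, dθ + 2π m⟩`, the sum being over all non-oriented `2`-cells of `Λ_j`. -/
def energy {bc : BC} {j : ℕ} (p : Config bc j) : ℝ :=
  ∑ f : BoxCell 4 2 BC.free j,
    (dTheta p f.1 + 2 * Real.pi * ((extendZero p.2 f.1 : ℤ) : ℝ)) ^ 2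

/-- The Villain coupling at inverse temperature `β`: the probability measure on the pairs `(θ, m)`
with `θ` valued in `[-π, π)` that is proportional to
`exp (-(β / 2) ⟨dθ + 2π m, dθ + 2π m⟩) dθ`. -/
def villain (bc : BC) (j : ℕ) (β : ℝ) : Measure (Config bc j) :=
  normalize
    ((((volume : Measure (BoxCell 4 1 bc j → ℝ)).restrict
        (Set.univ.pi fun _ => Set.Ico (-Real.pi) Real.pi)).prod
      (Measure.count : Measure (BoxCell 4 2 bc j → ℤ))).withDensity
        fun p => ENNReal.ofReal (Real.exp (-(β / 2) * energy p)))

/-- `M̃(β, f) = E[Var^{IG}(-dθ(f) / (2π), (2π)² β)]` for the Villain coupling on `Λ_j`. -/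
def tildeM (bc : BC) (j : ℕ) (β : ℝ) (f : OrientedCell 4 2) : ℝ :=
  ∫ p, varIG (-orientedValue (dTheta p) f / (2 * Real.pi)) ((2 * Real.pi) ^ 2 * β)
    ∂(villain bc j β)

end VillainGauge

end

/-! Summing out the integers turns `tildeM` into a ratio of integrals over angles: the weight is the
product over faces of `villainWeight β`, and the observable at the chosen face f₀ is the periodic
function `villainVar β` (`tildeM_eq`).

Let φ be a real 1-form with dφ(f₀) = π. Integrals of periodic functions are unchanged under θ → θ ±
φ, so the numerator may be averaged over both shifts. At a face other than f₀, Cauchy–Schwarz bounds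
the geometric mean of the shifted weights below by exp(-(β/2) dφ(f)²) times the original weight
(`exp_mul_villainWeight_le_sqrt`). At f₀ the shift by π makes two consecutive integers compete, so
weight times variance is at least about exp(-βπ²/2) times a weight at a larger inverse temperature γ
(`le_villainWeight_mul_villainVar`). Returning from γ to β costs only the factor √(β/γ): the
difference of the two weights has nonnegative Fourier coefficients, and so has its product with the
other weights (`sqrt_mul_integral_le`). The outcome is `le_tildeM`: `tildeM` ≥ c(ε) exp(-(β/2)‖dφ‖²
- βε).

It remains to make ‖dφ‖² nearly 2π² (`exists_test_form`). In dimension four there are 6 faces per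
site, while exact 2-forms have 4 - 1 = 3 degrees of freedom per site, so the projection onto exact
forms has average diagonal entry about 1/2. A dimension count in a large finite cube gives an almost
optimal finitely supported form at some face (`exists_curl_eq_one`), and translations and
permutations of the axes carry it to any face. Its support has bounded radius, which is why distance
from the boundary suffices for both boundary conditions. -/

noncomputable section

namespace VillainGauge

/-! ### The periodized Gaussian weight -/

/-- The Gaussian weight of the lift `x + 2πk` of an angle `x`. -/
def gaussTerm (β x : ℝ) (k : ℤ) : ℝ :=
  Real.exp (-(β / 2) * (x + 2 * Real.pi * k) ^ 2)

/-- The Villain weight `∑ₖ exp (-(β / 2) (x + 2πk) ^ 2)`. -/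
def villainWeight (β x : ℝ) : ℝ :=
  ∑' k : ℤ, gaussTerm β x k

lemma gaussTerm_pos (β x : ℝ) (k : ℤ) : 0 < gaussTerm β x k := Real.exp_pos _

lemma summable_pow_mul_gaussTerm {β : ℝ} (hβ : 0 < β) (x : ℝ) (j : ℕ) :
    Summable fun k : ℤ => (|k| : ℝ) ^ j * gaussTerm β x k := by
  -- Expanding the square, k² has coefficient -2π²β and the term linear in k is at most 2πβ|x||k|;
  -- this is the theta bound with parameters β|x| and 2πβ.
  have hT : 0 < 2 * Real.pi * β := by positivity
  refine (summable_pow_mul_jacobiTheta₂_term_bound (β * |x|) hT j).of_norm_bounded fun k => ?_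
  have h1 : (0 : ℝ) ≤ (|k| : ℝ) ^ j := by positivity
  rw [Real.norm_of_nonneg (mul_nonneg h1 (gaussTerm_pos _ _ _).le)]
  push_cast
  refine mul_le_mul_of_nonneg_left (Real.exp_le_exp.2 ?_) h1
  have h2 : -(x * k) ≤ |x| * |(k : ℝ)| := by
    rw [← abs_mul]; exact neg_le_abs _
  have h3 : 0 ≤ (2 * Real.pi * β) * (|x| * |(k : ℝ)| + x * k) :=
    mul_nonneg hT.le (by linarith)
  have h4 : 0 ≤ β * x ^ 2 := by positivity
  nlinarith

lemma summable_gaussTerm {β : ℝ} (hβ : 0 < β) (x : ℝ) : Summable (gaussTerm β x) := by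
  simpa using summable_pow_mul_gaussTerm hβ x 0

lemma villainWeight_pos {β : ℝ} (hβ : 0 < β) (x : ℝ) : 0 < villainWeight β x :=
  (summable_gaussTerm hβ x).tsum_pos (fun k => (gaussTerm_pos β x k).le) 0 (gaussTerm_pos β x 0)

lemma gaussTerm_add_two_pi_mul (β x : ℝ) (n k : ℤ) :
    gaussTerm β (x + 2 * Real.pi * n) k = gaussTerm β x (k + n) := by
  unfold gaussTerm; congr 1; push_cast; ring

lemma gaussTerm_neg (β x : ℝ) (k : ℤ) : gaussTerm β (-x) k = gaussTerm β x (-k) := by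
  unfold gaussTerm; congr 1; push_cast; ring

lemma villainWeight_add_two_pi_mul (β x : ℝ) (n : ℤ) :
    villainWeight β (x + 2 * Real.pi * n) = villainWeight β x := by
  simp only [villainWeight, gaussTerm_add_two_pi_mul]
  exact (Equiv.addRight n).tsum_eq (gaussTerm β x)

lemma villainWeight_neg (β x : ℝ) : villainWeight β (-x) = villainWeight β x := by
  simp only [villainWeight, gaussTerm_neg]
  exact (Equiv.neg ℤ).tsum_eq (gaussTerm β x)

@[fun_prop]
lemma measurable_gaussTerm (β : ℝ) (k : ℤ) : Measurable fun x => gaussTerm β x k := by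
  unfold gaussTerm; fun_prop

@[fun_prop]
lemma measurable_villainWeight (β : ℝ) : Measurable (villainWeight β) :=
  Measurable.tsum fun k => measurable_gaussTerm β k

/-- The Fourier coefficients of the Villain weight. -/
def villainCoeff (β : ℝ) (n : ℤ) : ℝ :=
  Real.sqrt (2 * Real.pi * β)⁻¹ * Real.exp (-(n : ℝ) ^ 2 / (2 * β))

lemma villainCoeff_pos {β : ℝ} (hβ : 0 < β) (n : ℤ) : 0 < villainCoeff β n := by
  unfold villainCoeff; positivity

lemma summable_villainCoeff {β : ℝ} (hβ : 0 < β) : Summable (villainCoeff β) := by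
  have h := summable_gaussTerm (β := (4 * Real.pi ^ 2 * β)⁻¹) (by positivity) 0
  refine (h.mul_left (Real.sqrt (2 * Real.pi * β)⁻¹)).congr fun n => ?_
  unfold villainCoeff gaussTerm
  congr 2
  field_simp
  ring

/-- Poisson summation, in the form of the functional equation of the theta series. -/
lemma ofReal_villainWeight_eq_tsum {β : ℝ} (hβ : 0 < β) (x : ℝ) :
    (villainWeight β x : ℂ) =
      ∑' n : ℤ, (villainCoeff β n : ℂ) * Complex.exp (Complex.I * (n * x)) := by
  set a : ℝ := (2 * Real.pi * β)⁻¹ with ha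
  have ha0 : 0 < a := by positivity
  have hpi : (Real.pi : ℂ) ≠ 0 := by exact_mod_cast Real.pi_ne_zero
  have hβ' : (β : ℂ) ≠ 0 := by exact_mod_cast hβ.ne'
  have hI : Complex.I ^ 2 = -1 := Complex.I_sq
  have hW : (villainWeight β x : ℂ) = ∑' n : ℤ, Complex.exp
      (-Real.pi / a * (n + Complex.I * -(Complex.I * (x / (2 * Real.pi)))) ^ 2) := by
    rw [villainWeight, Complex.ofReal_tsum]
    refine tsum_congr fun k => ?_
    unfold gaussTerm
    push_cast
    congr 1
    have : (k : ℂ) + Complex.I * -(Complex.I * (x / (2 * Real.pi))) = k + x / (2 * Real.pi) := by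
      linear_combination (-(x : ℂ) / (2 * Real.pi)) * hI
    rw [this, ha]
    push_cast
    field_simp
    ring
  have key' := Complex.tsum_exp_neg_quadratic (a := (a : ℂ)) (by simpa using ha0)
    (-(Complex.I * (x / (2 * Real.pi))))
  rw [← hW] at key'
  have hs : (1 : ℂ) / (a : ℂ) ^ (1 / 2 : ℂ) = ((Real.sqrt a)⁻¹ : ℝ) := by
    have h12 : (1 / 2 : ℂ) = ((1 / 2 : ℝ) : ℂ) := by push_cast; rfl
    rw [h12, ← Complex.ofReal_cpow ha0.le, ← Real.sqrt_eq_rpow]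
    push_cast; rw [one_div]
  rw [hs] at key'
  have hsa : (Real.sqrt a : ℂ) ≠ 0 := by exact_mod_cast (Real.sqrt_pos.2 ha0).ne'
  have : (villainWeight β x : ℂ) = (Real.sqrt a : ℂ) * ∑' n : ℤ, Complex.exp
      (-Real.pi * a * n ^ 2 + 2 * Real.pi * -(Complex.I * (x / (2 * Real.pi))) * n) := by
    rw [key']; push_cast; field_simp
  -- The functional equation produces exp(-inx), hence the reindexing n → -n.
  rw [this, ← tsum_mul_left, ← (Equiv.neg ℤ).tsum_eq]
  refine tsum_congr fun n => ?_
  simp only [Equiv.neg_apply, villainCoeff]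
  push_cast
  rw [← ha, mul_assoc (Real.sqrt a : ℂ), ← Complex.exp_add]
  congr 2
  rw [ha]
  push_cast
  field_simp

lemma hasSum_villainWeight {β : ℝ} (hβ : 0 < β) (x : ℝ) :
    HasSum (fun n : ℤ => (villainCoeff β n : ℂ) * Complex.exp (Complex.I * (n * x)))
      (villainWeight β x : ℂ) := by
  rw [ofReal_villainWeight_eq_tsum hβ]
  refine Summable.hasSum (Summable.of_norm ((summable_villainCoeff hβ).congr fun n => ?_))
  rw [norm_mul, Complex.norm_real, Real.norm_of_nonneg (villainCoeff_pos hβ n).le,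
    show Complex.I * ((n : ℂ) * x) = ((n * x : ℝ) : ℂ) * Complex.I by push_cast; ring,
    Complex.norm_exp_ofReal_mul_I, mul_one]

lemma villainWeight_le {β : ℝ} (hβ : 0 < β) (x : ℝ) :
    villainWeight β x ≤ ∑' n : ℤ, villainCoeff β n := by
  have h1 : ‖(villainWeight β x : ℂ)‖ ≤ ∑' n : ℤ, villainCoeff β n := by
    rw [ofReal_villainWeight_eq_tsum hβ]
    refine tsum_of_norm_bounded (summable_villainCoeff hβ).hasSum fun n => ?_
    rw [norm_mul, Complex.norm_real, Real.norm_of_nonneg (villainCoeff_pos hβ n).le,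
      show Complex.I * ((n : ℂ) * x) = ((n * x : ℝ) : ℂ) * Complex.I by push_cast; ring,
      Complex.norm_exp_ofReal_mul_I, mul_one]
  rw [Complex.norm_real] at h1
  exact (le_abs_self _).trans h1

/-- Shifting an angle by `±t` costs at most a Gaussian factor, in geometric mean. -/
lemma exp_mul_villainWeight_le_sqrt {β : ℝ} (hβ : 0 < β) (x t : ℝ) :
    Real.exp (-(β / 2) * t ^ 2) * villainWeight β x ≤
      Real.sqrt (villainWeight β (x + t)) * Real.sqrt (villainWeight β (x - t)) := by
  have hsq : ∀ y k, (Real.sqrt (gaussTerm β y k)) ^ (2 : ℝ) = gaussTerm β y k := fun y k => by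
    rw [Real.rpow_two, Real.sq_sqrt (gaussTerm_pos _ _ _).le]
  have h := Real.inner_le_Lp_mul_Lq_tsum_of_nonneg (p := 2) (q := 2)
    (f := fun k => Real.sqrt (gaussTerm β (x + t) k))
    (g := fun k => Real.sqrt (gaussTerm β (x - t) k)) Real.HolderConjugate.two_two
    (fun k => Real.sqrt_nonneg _) (fun k => Real.sqrt_nonneg _)
    (by simpa only [hsq] using summable_gaussTerm hβ _)
    (by simpa only [hsq] using summable_gaussTerm hβ _)
  simp only [hsq, ← Real.sqrt_eq_rpow] at h
  -- Since (z + t)² + (z - t)² = 2z² + 2t², the geometric mean of the two shifted terms is exactly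
  -- exp(-(β/2)t²) times the term at x.
  refine le_trans (le_of_eq ?_) h
  rw [villainWeight, ← tsum_mul_left]
  refine tsum_congr fun k => ?_
  unfold gaussTerm
  rw [← Real.exp_add, ← Real.sqrt_mul (Real.exp_pos _).le, ← Real.exp_add, Real.sqrt_eq_rpow,
    ← Real.exp_mul]
  congr 1
  ring

/-! ### The conditional variance of one integer variable -/

/-- The conditional variance of the integer variable at a face whose angle is `y`. -/
def villainVar (β y : ℝ) : ℝ :=
  varIG (-y / (2 * Real.pi)) ((2 * Real.pi) ^ 2 * β)

/-- The conditional mean of the integer variable at a face whose angle is `y`. -/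
def villainMean (β y : ℝ) : ℝ :=
  (∑' k : ℤ, (k : ℝ) * gaussTerm β y k) / villainWeight β y

/-- The conditional law of the integer variable at a face whose angle is `y`. -/
def villainLaw (β y : ℝ) : Measure ℤ :=
  igLaw (-y / (2 * Real.pi)) ((2 * Real.pi) ^ 2 * β)

lemma villainLaw_eq {β : ℝ} (hβ : 0 < β) (y : ℝ) :
    villainLaw β y = (ENNReal.ofReal (villainWeight β y))⁻¹ •
      (Measure.count : Measure ℤ).withDensity fun k => ENNReal.ofReal (gaussTerm β y k) := by
  have hpi := Real.pi_ne_zero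
  have h : ∀ k : ℤ, Real.exp (-((2 * Real.pi) ^ 2 * β / 2) * ((k : ℝ) - -y / (2 * Real.pi)) ^ 2)
      = gaussTerm β y k := fun k => by
    unfold gaussTerm; congr 1; field_simp; ring
  unfold villainLaw igLaw normalize
  simp only [h]
  congr 2
  rw [withDensity_apply _ MeasurableSet.univ, Measure.restrict_univ, lintegral_count, villainWeight,
    ENNReal.ofReal_tsum_of_nonneg (fun k => (gaussTerm_pos β y k).le) (summable_gaussTerm hβ y)]

lemma isProbabilityMeasure_villainLaw {β : ℝ} (hβ : 0 < β) (y : ℝ) :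
    IsProbabilityMeasure (villainLaw β y) := by
  refine ⟨?_⟩
  rw [villainLaw_eq hβ, Measure.smul_apply, withDensity_apply _ MeasurableSet.univ,
    Measure.restrict_univ, lintegral_count,
    ← ENNReal.ofReal_tsum_of_nonneg (fun k => (gaussTerm_pos β y k).le) (summable_gaussTerm hβ y)]
  exact ENNReal.inv_mul_cancel (by simpa using villainWeight_pos hβ y) ENNReal.ofReal_ne_top

lemma integral_villainLaw {β : ℝ} (hβ : 0 < β) (y : ℝ) {g : ℤ → ℝ}
    (hg : Summable fun k => g k * gaussTerm β y k) :
    ∫ k, g k ∂(villainLaw β y) = (∑' k, g k * gaussTerm β y k) / villainWeight β y := by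
  rw [villainLaw_eq hβ, integral_smul_measure, integral_withDensity_eq_integral_toReal_smul
    (measurable_of_countable _) (by simp)]
  have h : ∀ k, (ENNReal.ofReal (gaussTerm β y k)).toReal • g k = g k * gaussTerm β y k :=
    fun k => by rw [ENNReal.toReal_ofReal (gaussTerm_pos _ _ _).le, smul_eq_mul, mul_comm]
  simp only [h]
  have hi : Integrable (fun k => g k * gaussTerm β y k) (Measure.count : Measure ℤ) :=
    integrable_count_iff.2 hg.norm
  rw [integral_countable hi, ENNReal.toReal_inv,
    ENNReal.toReal_ofReal (villainWeight_pos hβ y).le]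
  simp [Measure.real, div_eq_inv_mul]

lemma summable_sq_mul_gaussTerm {β : ℝ} (hβ : 0 < β) (y c : ℝ) :
    Summable fun k : ℤ => ((k : ℝ) - c) ^ 2 * gaussTerm β y k := by
  have h := (((summable_pow_mul_gaussTerm hβ y 2)).add
    ((summable_gaussTerm hβ y).mul_left (c ^ 2))).mul_left 2
  refine h.of_nonneg_of_le (fun k => mul_nonneg (sq_nonneg _) (gaussTerm_pos _ _ _).le) fun k => ?_
  have h1 : ((k : ℝ) - c) ^ 2 ≤ 2 * ((|k| : ℝ) ^ 2 + c ^ 2) := by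
    rw [sq_abs]; nlinarith [sq_nonneg ((k : ℝ) + c)]
  have := mul_le_mul_of_nonneg_right h1 (gaussTerm_pos β y k).le
  linarith

lemma summable_mul_gaussTerm {β : ℝ} (hβ : 0 < β) (y : ℝ) :
    Summable fun k : ℤ => (k : ℝ) * gaussTerm β y k := by
  refine Summable.of_norm ((summable_pow_mul_gaussTerm hβ y 1).congr fun k => ?_)
  rw [norm_mul, Real.norm_of_nonneg (gaussTerm_pos β y k).le, Real.norm_eq_abs, pow_one]

lemma villainVar_eq {β : ℝ} (hβ : 0 < β) (y : ℝ) :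
    villainVar β y = (∑' k : ℤ, ((k : ℝ) - villainMean β y) ^ 2 * gaussTerm β y k) /
      villainWeight β y := by
  change variance (fun k : ℤ => (k : ℝ)) (villainLaw β y) = _
  rw [variance_eq_integral (measurable_of_countable _).aemeasurable,
    integral_villainLaw hβ y (summable_mul_gaussTerm hβ y)]
  exact integral_villainLaw hβ y (summable_sq_mul_gaussTerm hβ y _)

lemma villainVar_nonneg (β y : ℝ) : 0 ≤ villainVar β y := variance_nonneg _ _

lemma villainWeight_mul_villainVar {β : ℝ} (hβ : 0 < β) (y : ℝ) :
    villainWeight β y * villainVar β y =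
      ∑' k : ℤ, ((k : ℝ) - villainMean β y) ^ 2 * gaussTerm β y k := by
  rw [villainVar_eq hβ, mul_div_cancel₀ _ (villainWeight_pos hβ y).ne']

lemma measurable_villainVar {β : ℝ} (hβ : 0 < β) : Measurable (villainVar β) := by
  have h1 : Measurable (villainMean β) :=
    (Measurable.tsum fun k => (measurable_gaussTerm β k).const_mul _).div
      (measurable_villainWeight β)
  rw [funext (villainVar_eq hβ)]
  exact (Measurable.tsum fun k => ((h1.const_sub _).pow_const 2).mul (measurable_gaussTerm β k)).div
    (measurable_villainWeight β)

lemma villainMean_add_two_pi_mul {β : ℝ} (hβ : 0 < β) (y : ℝ) (n : ℤ) :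
    villainMean β (y + 2 * Real.pi * n) = villainMean β y - n := by
  simp only [villainMean, villainWeight_add_two_pi_mul, gaussTerm_add_two_pi_mul]
  have h : ∑' k : ℤ, (k : ℝ) * gaussTerm β y (k + n) =
      ∑' k : ℤ, (k : ℝ) * gaussTerm β y k - n * villainWeight β y := by
    rw [villainWeight, ← tsum_mul_left, ← (summable_mul_gaussTerm hβ y).tsum_sub
      ((summable_gaussTerm hβ y).mul_left _),
      ← (Equiv.addRight n).tsum_eq (fun k : ℤ => (k : ℝ) * gaussTerm β y k - n * gaussTerm β y k)]
    refine tsum_congr fun k => ?_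
    simp only [Equiv.coe_addRight]; push_cast; ring
  rw [h, sub_div, mul_div_cancel_right₀ _ (villainWeight_pos hβ y).ne']

lemma villainVar_add_two_pi_mul {β : ℝ} (hβ : 0 < β) (y : ℝ) (n : ℤ) :
    villainVar β (y + 2 * Real.pi * n) = villainVar β y := by
  rw [villainVar_eq hβ, villainVar_eq hβ, villainMean_add_two_pi_mul hβ,
    villainWeight_add_two_pi_mul]
  congr 1
  rw [← (Equiv.addRight n).tsum_eq (fun k : ℤ => ((k : ℝ) - villainMean β y) ^ 2 * gaussTerm β y k)]
  refine tsum_congr fun k => ?_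
  simp only [Equiv.coe_addRight, gaussTerm_add_two_pi_mul]; push_cast; ring

/-- Needed only for integrability. The variance is at most the second moment about -y/(2π), and half
of the Gaussian exponent absorbs the square. -/
lemma villainWeight_mul_villainVar_le {β : ℝ} (hβ : 0 < β) (y : ℝ) :
    villainWeight β y * villainVar β y ≤
      β⁻¹ * villainWeight (β / 2) y := by
  have hP := isProbabilityMeasure_villainLaw hβ y
  have hpi := Real.pi_pos
  have hm : AEStronglyMeasurable (fun k : ℤ => (k : ℝ)) (villainLaw β y) :=
    (measurable_of_countable _).aestronglyMeasurable
  have h1 : villainVar β y ≤ (∑' k : ℤ, ((k : ℝ) - -y / (2 * Real.pi)) ^ 2 * gaussTerm β y k) /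
      villainWeight β y := by
    rw [← integral_villainLaw hβ y (summable_sq_mul_gaussTerm hβ y _)]
    have h2 := variance_le_expectation_sq (μ := villainLaw β y)
      (X := fun k : ℤ => (k : ℝ) - -y / (2 * Real.pi))
      (measurable_of_countable _).aestronglyMeasurable
    rw [variance_sub_const hm] at h2
    exact h2
  rw [le_div_iff₀ (villainWeight_pos hβ y), mul_comm] at h1
  refine h1.trans ?_
  rw [villainWeight, ← tsum_mul_left]
  refine (summable_sq_mul_gaussTerm hβ y _).tsum_le_tsum (fun k => ?_)
    ((summable_gaussTerm (half_pos hβ) y).mul_left _)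
  set z := y + 2 * Real.pi * k with hz
  have h3 : ((k : ℝ) - -y / (2 * Real.pi)) ^ 2 = z ^ 2 / (2 * Real.pi) ^ 2 := by
    rw [hz]; field_simp; ring
  have h4 : gaussTerm β y k = gaussTerm (β / 2) y k * Real.exp (-(β / 4 * z ^ 2)) := by
    unfold gaussTerm; rw [← Real.exp_add, ← hz]; congr 1; ring
  have h5 : β / 4 * z ^ 2 * Real.exp (-(β / 4 * z ^ 2)) ≤ 1 := by
    have := Real.add_one_le_exp (β / 4 * z ^ 2)
    rw [Real.exp_neg, ← div_eq_mul_inv, div_le_one (Real.exp_pos _)]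
    linarith
  have h6 : z ^ 2 / (2 * Real.pi) ^ 2 * Real.exp (-(β / 4 * z ^ 2)) ≤ β⁻¹ := by
    have h7 : z ^ 2 / (2 * Real.pi) ^ 2 * Real.exp (-(β / 4 * z ^ 2)) =
      β⁻¹ * (4 / (2 * Real.pi) ^ 2) * (β / 4 * z ^ 2 * Real.exp (-(β / 4 * z ^ 2))) := by
      field_simp
    rw [h7]
    have h8 : 4 / (2 * Real.pi) ^ 2 ≤ 1 := by
      rw [div_le_one (by positivity)]; nlinarith [Real.pi_gt_three]
    calc _ ≤ β⁻¹ * 1 * 1 := by gcongr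
      _ = β⁻¹ := by ring
  rw [h3, h4]
  have := mul_le_mul_of_nonneg_left h6 (gaussTerm_pos (β / 2) y k).le
  linarith

/-- At distance `π` from the lattice of minima, the weight times the variance is at least
`exp (-π² β / 2)` times the weight at an arbitrarily larger inverse temperature. -/
lemma le_villainWeight_mul_villainVar {β ε : ℝ} (hβ : 0 < β) (hε : 0 < ε) (x : ℝ) :
    Real.exp (-(β * Real.pi ^ 2 / 2) - β * ε) / 4 *
        villainWeight ((1 + Real.pi ^ 2 / (2 * ε)) * β) x ≤
      villainWeight β (x + Real.pi) * villainVar β (x + Real.pi) := by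
  set γ := (1 + Real.pi ^ 2 / (2 * ε)) * β with hγ
  have hγ0 : 0 < γ := by positivity
  set μ := villainMean β (x + Real.pi)
  have hs := summable_sq_mul_gaussTerm hβ (x + Real.pi) μ
  have hs' : Summable fun k : ℤ =>
      (((k - 1 : ℤ) : ℝ) - μ) ^ 2 * gaussTerm β (x + Real.pi) (k - 1) :=
    (Equiv.subRight (1 : ℤ)).summable_iff.2 hs
  have hshift : ∑' k : ℤ, (((k - 1 : ℤ) : ℝ) - μ) ^ 2 * gaussTerm β (x + Real.pi) (k - 1) =
      ∑' k : ℤ, ((k : ℝ) - μ) ^ 2 * gaussTerm β (x + Real.pi) k :=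
    (Equiv.subRight (1 : ℤ)).tsum_eq
      (fun k : ℤ => ((k : ℝ) - μ) ^ 2 * gaussTerm β (x + Real.pi) k)
  -- Each k is paired with k - 1: after the shift by π their lifts are z + π and z - π, which have
  -- comparable weights for small z.
  have hdouble : villainWeight β (x + Real.pi) * villainVar β (x + Real.pi) =
      ∑' k : ℤ, ((((k : ℝ) - μ) ^ 2 * gaussTerm β (x + Real.pi) k +
        (((k - 1 : ℤ) : ℝ) - μ) ^ 2 * gaussTerm β (x + Real.pi) (k - 1)) / 2) := by
    rw [villainWeight_mul_villainVar hβ, tsum_div_const, hs.tsum_add hs', hshift]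
    ring
  rw [hdouble, villainWeight, ← tsum_mul_left]
  refine Summable.tsum_le_tsum (fun k => ?_) ((summable_gaussTerm hγ0 x).mul_left _)
    ((hs.add hs').div_const 2)
  set z := x + 2 * Real.pi * k with hz
  set m := Real.exp (-(β / 2) * (|z| + Real.pi) ^ 2) with hm
  have hpi := Real.pi_pos
  have hm0 : 0 < m := Real.exp_pos _
  have h1 : m ≤ gaussTerm β (x + Real.pi) k := by
    unfold gaussTerm
    refine Real.exp_le_exp.2 ?_
    rw [show x + Real.pi + 2 * Real.pi * k = z + Real.pi by rw [hz]; ring]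
    have : (z + Real.pi) ^ 2 ≤ (|z| + Real.pi) ^ 2 := by
      nlinarith [le_abs_self z, sq_abs z]
    nlinarith
  have h2 : m ≤ gaussTerm β (x + Real.pi) (k - 1) := by
    unfold gaussTerm
    refine Real.exp_le_exp.2 ?_
    rw [show x + Real.pi + 2 * Real.pi * ((k - 1 : ℤ) : ℝ) = z - Real.pi by
      rw [hz]; push_cast; ring]
    have : (z - Real.pi) ^ 2 ≤ (|z| + Real.pi) ^ 2 := by
      nlinarith [neg_abs_le z, sq_abs z]
    nlinarith
  -- The cross term βπ|z| is split by Young's inequality: its z² part raises β to γ, its constant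
  -- part costs exp(-βε).
  have h3 : Real.exp (-(β * Real.pi ^ 2 / 2) - β * ε) * gaussTerm γ x k ≤ m := by
    unfold gaussTerm
    rw [← Real.exp_add]
    refine Real.exp_le_exp.2 ?_
    rw [← hz, hγ]
    have hkey : 2 * Real.pi * |z| ≤ Real.pi ^ 2 / (2 * ε) * |z| ^ 2 + 2 * ε := by
      have : Real.pi ^ 2 / (2 * ε) * |z| ^ 2 + 2 * ε - 2 * Real.pi * |z| =
          (Real.pi * |z| - 2 * ε) ^ 2 / (2 * ε) := by field_simp; ring
      have h0 : 0 ≤ (Real.pi * |z| - 2 * ε) ^ 2 / (2 * ε) := by positivity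
      linarith
    rw [sq_abs] at hkey
    have hz2 := sq_abs z
    have := mul_le_mul_of_nonneg_left hkey hβ.le
    nlinarith
  -- No mean μ is close to two consecutive integers. With the 1/2 from the pairing this gives the
  -- constant 1/4.
  have h4 : (1 : ℝ) / 2 ≤ ((k : ℝ) - μ) ^ 2 + (((k - 1 : ℤ) : ℝ) - μ) ^ 2 := by
    push_cast; nlinarith [sq_nonneg (2 * ((k : ℝ) - μ) - 1)]
  have h5 := mul_le_mul_of_nonneg_left h1 (sq_nonneg ((k : ℝ) - μ))
  have h6 := mul_le_mul_of_nonneg_left h2 (sq_nonneg (((k - 1 : ℤ) : ℝ) - μ))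
  have h7 := mul_le_mul_of_nonneg_right h4 hm0.le
  linarith

/-! ### Integration of periodic functions over a cube -/

/-- Lebesgue measure on `[-π, π)^E`. -/
def cubeMeasure (E : Type*) [Fintype E] : Measure (E → ℝ) :=
  (volume : Measure (E → ℝ)).restrict (Set.univ.pi fun _ => Set.Ico (-Real.pi) Real.pi)

lemma cubeMeasure_eq_pi (E : Type*) [Fintype E] :
    cubeMeasure E = Measure.pi fun _ => (volume : Measure ℝ).restrict
      (Set.Ico (-Real.pi) Real.pi) := by
  rw [cubeMeasure, volume_pi, Measure.restrict_pi_pi]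

instance (E : Type*) [Fintype E] : IsFiniteMeasure (cubeMeasure E) := by
  rw [cubeMeasure_eq_pi]; infer_instance

lemma cubeMeasure_ne_zero (E : Type*) [Fintype E] : cubeMeasure E ≠ 0 := by
  intro h
  have h1 : cubeMeasure E Set.univ = 0 := by rw [h]; simp
  rw [cubeMeasure, Measure.restrict_apply_univ, Real.volume_pi_Ico] at h1
  rw [Finset.prod_eq_zero_iff] at h1
  obtain ⟨_, _, h2⟩ := h1
  rw [ENNReal.ofReal_eq_zero] at h2
  linarith [Real.pi_pos]

/-- Translation by `c` modulo `2π`, with values in `[-π, π)`. -/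
def angleShift (c x : ℝ) : ℝ := toIcoMod Real.two_pi_pos (-Real.pi) (x + c)

lemma exists_angleShift_eq (c x : ℝ) : ∃ n : ℤ, angleShift c x = x + c + 2 * Real.pi * n := by
  refine ⟨-toIcoDiv Real.two_pi_pos (-Real.pi) (x + c), ?_⟩
  have := toIcoMod_add_toIcoDiv_zsmul Real.two_pi_pos (-Real.pi) (x + c)
  rw [zsmul_eq_mul] at this
  unfold angleShift
  push_cast
  linarith

lemma measurable_angleShift (c : ℝ) : Measurable (angleShift c) := by
  have : angleShift c = fun x => -Real.pi + Int.fract ((x + c - -Real.pi) / (2 * Real.pi)) *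
      (2 * Real.pi) := by
    funext x
    rw [angleShift, toIcoMod_eq_add_fract_mul]
  rw [this]
  exact ((measurable_fract.comp (by fun_prop)).mul_const _).const_add _

lemma measurePreserving_angleShift (c : ℝ) :
    MeasurePreserving (angleShift c) ((volume : Measure ℝ).restrict (Set.Ico (-Real.pi) Real.pi))
      ((volume : Measure ℝ).restrict (Set.Ico (-Real.pi) Real.pi)) := by
  refine ⟨measurable_angleShift c, ?_⟩
  ext A hA
  rw [Measure.map_apply (measurable_angleShift c) hA,
    Measure.restrict_apply (measurable_angleShift c hA), Measure.restrict_apply hA]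
  -- B is the 2π-periodic extension of A ∩ [-π, π). The claim becomes that B has the same measure in
  -- any two intervals of length 2π, both being fundamental domains of 2πℤ.
  set B := angleShift 0 ⁻¹' A with hB
  have hBm : MeasurableSet B := measurable_angleShift 0 hA
  have h1 : angleShift c ⁻¹' A ∩ Set.Ico (-Real.pi) Real.pi =
      (fun x => x + c) ⁻¹' (B ∩ Set.Ico (-Real.pi + c) (Real.pi + c)) := by
    ext x
    simp [hB, angleShift]
  have h2 : A ∩ Set.Ico (-Real.pi) Real.pi = B ∩ Set.Ico (-Real.pi) Real.pi := by
    ext x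
    simp only [Set.mem_inter_iff, hB, Set.mem_preimage, angleShift, add_zero]
    refine and_congr_left fun hx => ?_
    rw [(toIcoMod_eq_self Real.two_pi_pos).2 (by convert! hx using 2; ring)]
  rw [h1, h2, measure_preimage_add_right]
  have h3 : ∀ t : ℝ, volume (B ∩ Set.Ico (-Real.pi + t) (Real.pi + t)) =
      volume (B ∩ Set.Ioc (-Real.pi + t) (-Real.pi + t + 2 * Real.pi)) := fun t => by
    rw [show -Real.pi + t + 2 * Real.pi = Real.pi + t by ring]
    exact measure_congr (ae_eq_set_inter (ae_eq_refl _) Ico_ae_eq_Ioc)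
  have h4 := h3 0
  simp only [add_zero] at h4
  rw [h3, h4]
  refine IsAddFundamentalDomain.measure_set_eq
    (G := AddSubgroup.zmultiples (2 * Real.pi))
    (isAddFundamentalDomain_Ioc Real.two_pi_pos _) (isAddFundamentalDomain_Ioc Real.two_pi_pos _)
    hBm ?_
  rintro ⟨g, hg⟩
  obtain ⟨n, rfl⟩ := AddSubgroup.mem_zmultiples_iff.1 hg
  ext x
  simp only [hB, Set.mem_preimage, angleShift, add_zero, AddSubgroup.mk_vadd, vadd_eq_add]
  rw [add_comm, toIcoMod_add_zsmul]

lemma integral_cubeMeasure_add {E : Type*} [Fintype E] {g : (E → ℝ) → ℝ} (hg : Measurable g)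
    (hper : ∀ (θ : E → ℝ) (n : E → ℤ), g (fun e => θ e + 2 * Real.pi * n e) = g θ)
    (φ : E → ℝ) : ∫ θ, g (θ + φ) ∂(cubeMeasure E) = ∫ θ, g θ ∂(cubeMeasure E) := by
  have hmp : MeasurePreserving (fun (θ : E → ℝ) e => angleShift (φ e) (θ e)) (cubeMeasure E)
      (cubeMeasure E) := by
    rw [cubeMeasure_eq_pi]
    exact measurePreserving_pi _ _ fun e => measurePreserving_angleShift (φ e)
  conv_rhs => rw [← hmp.map_eq, integral_map hmp.measurable.aemeasurable hg.aestronglyMeasurable]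
  refine integral_congr_ae (Eventually.of_forall fun θ => ?_)
  choose n hn using fun e => exists_angleShift_eq (φ e) (θ e)
  simp only [hn]
  exact (hper (θ + φ) n).symm

/-! ### Functions with nonnegative Fourier coefficients -/

/-- The character of the torus `(ℝ / 2πℤ)^E` with frequency `n`. -/
def character {E : Type*} [Fintype E] (n : E → ℤ) (θ : E → ℝ) : ℂ :=
  Complex.exp (((∑ e, n e * θ e : ℝ) : ℂ) * Complex.I)

lemma norm_character {E : Type*} [Fintype E] (n : E → ℤ) (θ : E → ℝ) : ‖character n θ‖ = 1 :=
  Complex.norm_exp_ofReal_mul_I _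

lemma continuous_character {E : Type*} [Fintype E] (n : E → ℤ) : Continuous (character n) := by
  unfold character; fun_prop

lemma character_zero {E : Type*} [Fintype E] (θ : E → ℝ) : character 0 θ = 1 := by
  simp [character]

lemma character_add {E : Type*} [Fintype E] (n m : E → ℤ) (θ : E → ℝ) :
    character (n + m) θ = character n θ * character m θ := by
  simp only [character, Pi.add_apply, Int.cast_add, add_mul, Finset.sum_add_distrib,
    Complex.ofReal_add, Complex.exp_add]

lemma norm_ofReal_mul_character {E : Type*} [Fintype E] {a : ℝ} (ha : 0 ≤ a) (n : E → ℤ)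
    (θ : E → ℝ) : ‖(a : ℂ) * character n θ‖ = a := by
  rw [norm_mul, norm_character, mul_one, Complex.norm_real, Real.norm_of_nonneg ha]

/-- A sum of characters of the torus `(ℝ / 2πℤ)^E` with nonnegative summable coefficients. -/
def HasNonnegFourier {E : Type*} [Fintype E] (g : (E → ℝ) → ℂ) : Prop :=
  ∃ (ι : Type) (_ : Countable ι) (a : ι → ℝ) (n : ι → E → ℤ), (∀ i, 0 ≤ a i) ∧ Summable a ∧
    ∀ θ : E → ℝ, HasSum (fun i => (a i : ℂ) * character (n i) θ) (g θ)

lemma hasNonnegFourier_one {E : Type*} [Fintype E] :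
    HasNonnegFourier (fun _ : E → ℝ => (1 : ℂ)) := by
  refine ⟨Unit, inferInstance, fun _ => 1, fun _ => 0, fun _ => zero_le_one, ?_, fun θ => ?_⟩
  · exact (hasSum_fintype _).summable
  · simp [character_zero]

/-- Frequencies may repeat in the family, so the product is indexed by pairs and no convolution has
to be formed. -/
lemma HasNonnegFourier.mul {E : Type*} [Fintype E] {g h : (E → ℝ) → ℂ}
    (hg : HasNonnegFourier g) (hh : HasNonnegFourier h) :
    HasNonnegFourier fun θ => g θ * h θ := by
  obtain ⟨ι, _, a, n, ha, hsa, hg⟩ := hg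
  obtain ⟨κ, _, b, m, hb, hsb, hh⟩ := hh
  have hsab : Summable fun p : ι × κ => a p.1 * b p.2 :=
    hsa.mul_of_nonneg hsb (Pi.le_def.2 ha) (Pi.le_def.2 hb)
  refine ⟨ι × κ, inferInstance, fun p => a p.1 * b p.2, fun p => n p.1 + m p.2,
    fun p => mul_nonneg (ha p.1) (hb p.2), hsab, fun θ => ?_⟩
  have h1 : Summable fun i => ‖(a i : ℂ) * character (n i) θ‖ :=
    hsa.congr fun i => (norm_ofReal_mul_character (ha i) _ _).symm
  have h2 : Summable fun i => ‖(b i : ℂ) * character (m i) θ‖ :=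
    hsb.congr fun i => (norm_ofReal_mul_character (hb i) _ _).symm
  have hs : HasSum (fun p : ι × κ => ((a p.1 : ℂ) * character (n p.1) θ) *
      ((b p.2 : ℂ) * character (m p.2) θ)) (g θ * h θ) :=
    HasSum.mul (f := fun i => (a i : ℂ) * character (n i) θ)
      (g := fun i => (b i : ℂ) * character (m i) θ) (hg θ) (hh θ)
      (summable_mul_of_summable_norm (f := fun i => (a i : ℂ) * character (n i) θ)
        (g := fun i => (b i : ℂ) * character (m i) θ) h1 h2)
  have he : (fun p : ι × κ => ((a p.1 * b p.2 : ℝ) : ℂ) * character (n p.1 + m p.2) θ) =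
      fun p => ((a p.1 : ℂ) * character (n p.1) θ) * ((b p.2 : ℂ) * character (m p.2) θ) := by
    funext p
    rw [character_add, Complex.ofReal_mul, mul_mul_mul_comm]
  rw [he]
  exact hs

lemma HasNonnegFourier.prod {E F : Type*} [Fintype E] (s : Finset F) {g : F → (E → ℝ) → ℂ}
    (hg : ∀ f ∈ s, HasNonnegFourier (g f)) : HasNonnegFourier fun θ => ∏ f ∈ s, g f θ := by
  classical
  induction s using Finset.induction_on with
  | empty => simpa using hasNonnegFourier_one
  | insert f s hf ih =>
    simp only [Finset.prod_insert hf]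
    exact (hg f (by simp)).mul (ih fun f' h => hg f' (by simp [h]))

lemma integral_character_nonneg {E : Type*} [Fintype E] (n : E → ℤ) :
    ∃ r : ℝ, 0 ≤ r ∧
      ∫ θ : E → ℝ, character n θ ∂(cubeMeasure E) = r := by
  have h1 : ∀ k : ℤ, ∃ r : ℝ, 0 ≤ r ∧
      ∫ x in Set.Ico (-Real.pi) Real.pi, Complex.exp (k * (x : ℂ) * Complex.I) = r := by
    intro k
    rw [integral_Ico_eq_integral_Ioc, ← intervalIntegral.integral_of_le (by linarith [Real.pi_pos])]
    rcases eq_or_ne k 0 with rfl | hk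
    · refine ⟨2 * Real.pi, by positivity, ?_⟩
      simp
      ring
    · refine ⟨0, le_rfl, ?_⟩
      have hk' : Complex.I * (k : ℂ) ≠ 0 :=
        mul_ne_zero Complex.I_ne_zero (by exact_mod_cast hk)
      simp only [mul_comm _ Complex.I, ← mul_assoc]
      rw [integral_exp_mul_complex hk']
      have : Complex.exp (Complex.I * k * (Real.pi : ℝ)) =
          Complex.exp (Complex.I * k * ((-Real.pi : ℝ) : ℂ)) := by
        rw [Complex.exp_eq_exp_iff_exists_int]
        exact ⟨k, by push_cast; ring⟩
      rw [this]; simp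
  choose r hr h using h1
  refine ⟨∏ e, r (n e), Finset.prod_nonneg fun e _ => hr _, ?_⟩
  simp only [character, Complex.ofReal_sum, Complex.ofReal_mul, Complex.ofReal_intCast,
    Finset.sum_mul, Complex.exp_sum]
  rw [cubeMeasure_eq_pi, integral_fintype_prod_eq_prod
    (f := fun (e : E) (x : ℝ) => Complex.exp (n e * (x : ℂ) * Complex.I))]
  simp only [h, Complex.ofReal_prod]

/-- Integration is term by term; a character integrates to zero unless its frequency is zero. -/
lemma HasNonnegFourier.integral_nonneg {E : Type*} [Fintype E] {g : (E → ℝ) → ℝ}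
    (hg : HasNonnegFourier fun θ => (g θ : ℂ)) : 0 ≤ ∫ θ, g θ ∂(cubeMeasure E) := by
  obtain ⟨ι, _, a, n, ha, hsa, hg⟩ := hg
  choose r hr h using fun i => integral_character_nonneg (n i)
  have key := hasSum_integral_of_summable_integral_norm (μ := cubeMeasure E)
    (F := fun i (θ : E → ℝ) => (a i : ℂ) * character (n i) θ)
    (fun i => (integrable_const (a i)).mono'
      (continuous_const.mul (continuous_character (n i))).aestronglyMeasurable
      (Eventually.of_forall fun θ => (norm_ofReal_mul_character (ha i) _ _).le))
    (by simpa only [norm_ofReal_mul_character (ha _), integral_const, smul_eq_mul]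
      using hsa.mul_left _)
  simp only [fun θ => (hg θ).tsum_eq, integral_const_mul, h] at key
  rw [integral_complex_ofReal] at key
  simp only [← Complex.ofReal_mul] at key
  rw [Complex.hasSum_ofReal] at key
  exact key.nonneg fun i => mul_nonneg (ha i) (hr i)

/-! ### The Villain model with a general integer incidence matrix -/

section Incidence

variable {E F : Type*} [Fintype E]

/-- The angle at `f` for the integer incidence matrix `s`. -/
def incAngle (s : F → E → ℤ) (θ : E → ℝ) (f : F) : ℝ :=
  ∑ e, s f e * θ e

@[fun_prop]
lemma measurable_incAngle (s : F → E → ℤ) (f : F) : Measurable fun θ => incAngle s θ f := by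
  unfold incAngle; fun_prop

lemma incAngle_add (s : F → E → ℤ) (θ φ : E → ℝ) (f : F) :
    incAngle s (θ + φ) f = incAngle s θ f + incAngle s φ f := by
  simp [incAngle, mul_add, Finset.sum_add_distrib]

lemma incAngle_neg (s : F → E → ℤ) (θ : E → ℝ) (f : F) :
    incAngle s (-θ) f = -incAngle s θ f := by
  simp [incAngle]

lemma incAngle_add_two_pi_mul (s : F → E → ℤ) (θ : E → ℝ) (n : E → ℤ) (f : F) :
    incAngle s (fun e => θ e + 2 * Real.pi * n e) f =
      incAngle s θ f + 2 * Real.pi * ((∑ e, s f e * n e : ℤ) : ℝ) := by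
  simp only [incAngle, mul_add, Finset.sum_add_distrib, Int.cast_sum, Int.cast_mul,
    Finset.mul_sum]
  congr 1
  exact Finset.sum_congr rfl fun e _ => by ring

lemma character_mul_incidence (s : F → E → ℤ) (θ : E → ℝ) (f : F) (k : ℤ) :
    character (fun e => k * s f e) θ = Complex.exp (Complex.I * (k * (incAngle s θ f : ℂ))) := by
  unfold character incAngle
  congr 1
  push_cast
  rw [mul_comm]
  congr 1
  rw [Finset.mul_sum]
  exact Finset.sum_congr rfl fun e _ => by ring

lemma hasNonnegFourier_villainWeight {β : ℝ} (hβ : 0 < β) (s : F → E → ℤ) (f : F) :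
    HasNonnegFourier fun θ : E → ℝ => (villainWeight β (incAngle s θ f) : ℂ) := by
  refine ⟨ℤ, inferInstance, villainCoeff β, fun k e => k * s f e,
    fun k => (villainCoeff_pos hβ k).le, summable_villainCoeff hβ, fun θ => ?_⟩
  simp only [character_mul_incidence]
  exact hasSum_villainWeight hβ _

/-- The prefactors have ratio exactly √(β/γ), and exp(-n²/(2β)) increases with β. -/
lemma sqrt_mul_villainCoeff_le {β γ : ℝ} (hβ : 0 < β) (hγ : β ≤ γ) (n : ℤ) :
    Real.sqrt (β / γ) * villainCoeff β n ≤ villainCoeff γ n := by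
  have hγ0 := hβ.trans_le hγ
  unfold villainCoeff
  rw [← mul_assoc, ← Real.sqrt_mul (by positivity),
    show β / γ * (2 * Real.pi * β)⁻¹ = (2 * Real.pi * γ)⁻¹ by field_simp]
  refine mul_le_mul_of_nonneg_left (Real.exp_le_exp.2 ?_) (Real.sqrt_nonneg _)
  rw [neg_div, neg_div, neg_le_neg_iff]
  exact div_le_div_of_nonneg_left (sq_nonneg _) (by positivity) (by linarith)

lemma hasNonnegFourier_villainWeight_sub {β γ : ℝ} (hβ : 0 < β) (hγ : β ≤ γ) (s : F → E → ℤ)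
    (f : F) : HasNonnegFourier fun θ : E → ℝ =>
      ((villainWeight γ (incAngle s θ f) : ℂ) -
        (Real.sqrt (β / γ) : ℂ) * (villainWeight β (incAngle s θ f) : ℂ)) := by
  have hγ0 := hβ.trans_le hγ
  refine ⟨ℤ, inferInstance, fun k => villainCoeff γ k - Real.sqrt (β / γ) * villainCoeff β k,
    fun k e => k * s f e, fun k => sub_nonneg.2 (sqrt_mul_villainCoeff_le hβ hγ k),
    (summable_villainCoeff hγ0).sub ((summable_villainCoeff hβ).mul_left _), fun θ => ?_⟩
  simp only [character_mul_incidence]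
  have h := (hasSum_villainWeight hγ0 (incAngle s θ f)).sub
    ((hasSum_villainWeight hβ (incAngle s θ f)).mul_left (Real.sqrt (β / γ) : ℂ))
  convert! h using 1
  funext k
  push_cast
  ring

/-- The product of the Villain weights over a set of faces. -/
def weightProd (s : F → E → ℤ) (β : ℝ) (S : Finset F) (θ : E → ℝ) : ℝ :=
  ∏ f ∈ S, villainWeight β (incAngle s θ f)

@[fun_prop]
lemma measurable_weightProd (s : F → E → ℤ) (β : ℝ) (S : Finset F) :
    Measurable (weightProd s β S) :=
  Finset.measurable_fun_prod _ fun f _ => (measurable_villainWeight β).comp (measurable_incAngle s f)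

lemma weightProd_pos (s : F → E → ℤ) {β : ℝ} (hβ : 0 < β) (S : Finset F) (θ : E → ℝ) :
    0 < weightProd s β S θ :=
  Finset.prod_pos fun _ _ => villainWeight_pos hβ _

lemma weightProd_le (s : F → E → ℤ) {β : ℝ} (hβ : 0 < β) (S : Finset F) (θ : E → ℝ) :
    weightProd s β S θ ≤ (∑' n : ℤ, villainCoeff β n) ^ S.card := by
  rw [← Finset.prod_const]
  exact Finset.prod_le_prod (fun _ _ => (villainWeight_pos hβ _).le) fun _ _ => villainWeight_le hβ _

lemma weightProd_add_two_pi_mul (s : F → E → ℤ) (β : ℝ) (S : Finset F) (θ : E → ℝ) (n : E → ℤ) :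
    weightProd s β S (fun e => θ e + 2 * Real.pi * n e) = weightProd s β S θ := by
  simp only [weightProd, incAngle_add_two_pi_mul, villainWeight_add_two_pi_mul]

lemma integrable_weightProd_mul (s : F → E → ℤ) {β : ℝ} (hβ : 0 < β) (S : Finset F)
    {u : (E → ℝ) → ℝ} (hu : Measurable u) {C : ℝ} (hC : ∀ θ, |u θ| ≤ C) :
    Integrable (fun θ => weightProd s β S θ * u θ) (cubeMeasure E) := by
  refine Integrable.of_bound ((measurable_weightProd s β S).mul hu).aestronglyMeasurable
    ((∑' n : ℤ, villainCoeff β n) ^ S.card * C) (Eventually.of_forall fun θ => ?_)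
  rw [norm_mul, Real.norm_of_nonneg (weightProd_pos s hβ S θ).le, Real.norm_eq_abs]
  exact mul_le_mul (weightProd_le s hβ S θ) (hC θ) (abs_nonneg _)
    ((weightProd_pos s hβ S θ).le.trans (weightProd_le s hβ S θ))

lemma abs_villainWeight_le {β : ℝ} (hβ : 0 < β) (x : ℝ) :
    |villainWeight β x| ≤ ∑' n : ℤ, villainCoeff β n := by
  rw [abs_of_pos (villainWeight_pos hβ x)]; exact villainWeight_le hβ x

/-- Raising the inverse temperature at one face decreases the partition function at most by the
ratio of the normalizations. -/
lemma sqrt_mul_integral_le (s : F → E → ℤ) {β γ : ℝ} (hβ : 0 < β) (hγ : β ≤ γ) (S : Finset F)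
    (f : F) :
    Real.sqrt (β / γ) *
        ∫ θ, weightProd s β S θ * villainWeight β (incAngle s θ f) ∂(cubeMeasure E) ≤
      ∫ θ, weightProd s β S θ * villainWeight γ (incAngle s θ f) ∂(cubeMeasure E) := by
  have hγ0 := hβ.trans_le hγ
  have h : HasNonnegFourier fun θ : E → ℝ => ((weightProd s β S θ *
      (villainWeight γ (incAngle s θ f) -
        Real.sqrt (β / γ) * villainWeight β (incAngle s θ f)) : ℝ) : ℂ) := by
    simp only [weightProd, Complex.ofReal_mul, Complex.ofReal_prod, Complex.ofReal_sub]
    exact (HasNonnegFourier.prod S fun f' _ => hasNonnegFourier_villainWeight hβ s f').mul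
      (hasNonnegFourier_villainWeight_sub hβ hγ s f)
  have h1 := h.integral_nonneg
  have hi := fun {δ : ℝ} (hδ : 0 < δ) => integrable_weightProd_mul s hβ S
    ((measurable_villainWeight δ).comp (measurable_incAngle s f))
    (fun θ => abs_villainWeight_le hδ (incAngle s θ f))
  simp only [Function.comp_def] at hi
  simp only [mul_sub] at h1
  have h2 : ∀ θ : E → ℝ, weightProd s β S θ *
      (Real.sqrt (β / γ) * villainWeight β (incAngle s θ f)) =
      Real.sqrt (β / γ) * (weightProd s β S θ * villainWeight β (incAngle s θ f)) :=
    fun θ => by ring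
  simp only [h2] at h1
  rw [integral_sub (hi hγ0) ((hi hβ).const_mul _), integral_const_mul] at h1
  linarith

/-- The one-face bounds are multiplied before the arithmetic–geometric mean inequality is applied; a
sum of two shifts can then be integrated by translation invariance. -/
lemma exp_mul_weightProd_le (s : F → E → ℤ) {β : ℝ} (hβ : 0 < β) (S : Finset F) (θ φ : E → ℝ) :
    Real.exp (-(β / 2) * ∑ f ∈ S, incAngle s φ f ^ 2) * weightProd s β S θ ≤
      (weightProd s β S (θ + φ) + weightProd s β S (θ + -φ)) / 2 := by
  have h1 : Real.exp (-(β / 2) * ∑ f ∈ S, incAngle s φ f ^ 2) * weightProd s β S θ ≤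
      Real.sqrt (weightProd s β S (θ + φ)) * Real.sqrt (weightProd s β S (θ + -φ)) := by
    unfold weightProd
    rw [Finset.mul_sum, Real.exp_sum, Real.sqrt_prod _ fun f _ => (villainWeight_pos hβ _).le,
      Real.sqrt_prod _ fun f _ => (villainWeight_pos hβ _).le, ← Finset.prod_mul_distrib,
      ← Finset.prod_mul_distrib]
    refine Finset.prod_le_prod
      (fun f _ => mul_nonneg (Real.exp_pos _).le (villainWeight_pos hβ _).le) fun f _ => ?_
    rw [incAngle_add, incAngle_add, incAngle_neg, ← sub_eq_add_neg]
    exact exp_mul_villainWeight_le_sqrt hβ _ _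
  have h2 := Real.sq_sqrt (weightProd_pos s hβ S (θ + φ)).le
  have h3 := Real.sq_sqrt (weightProd_pos s hβ S (θ + -φ)).le
  nlinarith [sq_nonneg (Real.sqrt (weightProd s β S (θ + φ)) -
    Real.sqrt (weightProd s β S (θ + -φ)))]

/-- The lower bound for the expected conditional variance at the face `f₀`, in terms of the energy
of a real form `φ` with angle `π` at `f₀`. -/
theorem le_integral_villainVar [Fintype F] [DecidableEq F] (s : F → E → ℤ) {β ε : ℝ} (hβ : 0 < β)
    (hε : 0 < ε) (σ : ℤˣ) (f₀ : F) (φ : E → ℝ) (hφ : incAngle s φ f₀ = Real.pi) :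
    Real.exp (-(β / 2) * ∑ f, incAngle s φ f ^ 2 - β * ε) *
        (Real.sqrt (1 + Real.pi ^ 2 / (2 * ε))⁻¹ / 4) *
        ∫ θ, weightProd s β Finset.univ θ ∂(cubeMeasure E) ≤
      ∫ θ, weightProd s β Finset.univ θ * villainVar β (((σ : ℤ) : ℝ) * incAngle s θ f₀)
        ∂(cubeMeasure E) := by
  -- The Cauchy–Schwarz bound is applied off f₀ only; at f₀ the shift by π has to create variance.
  set S : Finset F := Finset.univ.erase f₀ with hS
  set γ : ℝ := (1 + Real.pi ^ 2 / (2 * ε)) * β with hγ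
  have hK : (1 : ℝ) ≤ 1 + Real.pi ^ 2 / (2 * ε) := le_add_of_nonneg_right (by positivity)
  have hγ1 : β ≤ γ := le_mul_of_one_le_left hβ.le hK
  have hγ0 : 0 < γ := hβ.trans_le hγ1
  have hprod : ∀ θ, weightProd s β Finset.univ θ =
      weightProd s β S θ * villainWeight β (incAngle s θ f₀) := fun θ => by
    rw [weightProd, weightProd, hS, Finset.prod_erase_mul _ _ (Finset.mem_univ f₀)]
  set U : ℝ → ℝ := fun x => villainWeight β x * villainVar β (((σ : ℤ) : ℝ) * x) with hU
  have hUeq : ∀ x, U x = villainWeight β (((σ : ℤ) : ℝ) * x) *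
      villainVar β (((σ : ℤ) : ℝ) * x) := fun x => by
    rcases Int.units_eq_one_or σ with h | h <;> simp [hU, h, villainWeight_neg]
  have hUper : ∀ (x : ℝ) (n : ℤ), U (x + 2 * Real.pi * n) = U x := fun x n => by
    have : ((σ : ℤ) : ℝ) * (x + 2 * Real.pi * n) =
        ((σ : ℤ) : ℝ) * x + 2 * Real.pi * (((σ : ℤ) * n : ℤ) : ℝ) := by push_cast; ring
    rw [hUeq, hUeq, this, villainWeight_add_two_pi_mul, villainVar_add_two_pi_mul hβ]
  have hUm : Measurable U := (measurable_villainWeight β).mul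
    ((measurable_villainVar hβ).comp (measurable_const_mul _))
  have hU0 : ∀ x, 0 ≤ U x := fun x =>
    mul_nonneg (villainWeight_pos hβ _).le (villainVar_nonneg _ _)
  have hUb : ∀ x, |U x| ≤ β⁻¹ * ∑' n : ℤ, villainCoeff (β / 2) n := fun x => by
    rw [abs_of_nonneg (hU0 x), hUeq]
    exact (villainWeight_mul_villainVar_le hβ _).trans
      (mul_le_mul_of_nonneg_left (villainWeight_le (half_pos hβ) _) (by positivity))
  have hUlow : ∀ x, Real.exp (-(β * Real.pi ^ 2 / 2) - β * ε) / 4 * villainWeight γ x ≤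
      U (x + Real.pi) := fun x => by
    have h := le_villainWeight_mul_villainVar hβ hε (((σ : ℤ) : ℝ) * x)
    rw [← hγ] at h
    rcases Int.units_eq_one_or σ with h1 | h1
    · simpa [hU, h1] using h
    · simp only [h1, Units.val_neg, Units.val_one, Int.cast_neg, Int.cast_one, neg_mul, one_mul,
        villainWeight_neg] at h
      refine h.trans (le_of_eq ?_)
      have h2 := hUper (x - Real.pi) 1
      rw [show x - Real.pi + 2 * Real.pi * ((1 : ℤ) : ℝ) = x + Real.pi by push_cast; ring] at h2
      rw [h2, hUeq, h1]
      simp only [Units.val_neg, Units.val_one, Int.cast_neg, Int.cast_one, neg_mul, one_mul,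
        neg_sub]
      rw [show -x + Real.pi = Real.pi - x by ring]
  set H : (E → ℝ) → ℝ := fun θ => weightProd s β S θ * U (incAngle s θ f₀) with hH
  have hHm : Measurable H := (measurable_weightProd s β S).mul (hUm.comp (measurable_incAngle s f₀))
  have hHper : ∀ (θ : E → ℝ) (n : E → ℤ), H (fun e => θ e + 2 * Real.pi * n e) = H θ :=
    fun θ n => by
      simp only [hH, weightProd_add_two_pi_mul, incAngle_add_two_pi_mul, hUper]
  have hHint : Integrable H (cubeMeasure E) :=
    integrable_weightProd_mul s hβ S (hUm.comp (measurable_incAngle s f₀)) fun θ => hUb _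
  have hshift : ∀ ψ : E → ℝ, Integrable (fun θ => H (θ + ψ)) (cubeMeasure E) := fun ψ => by
    have hb : ∀ θ, ‖H θ‖ ≤ (∑' n : ℤ, villainCoeff β n) ^ S.card *
        (β⁻¹ * ∑' n : ℤ, villainCoeff (β / 2) n) := fun θ => by
      rw [norm_mul, Real.norm_of_nonneg (weightProd_pos s hβ S θ).le, Real.norm_eq_abs]
      exact mul_le_mul (weightProd_le s hβ S θ) (hUb _) (abs_nonneg _)
        ((weightProd_pos s hβ S θ).le.trans (weightProd_le s hβ S θ))
    exact Integrable.of_bound (hHm.comp (measurable_add_const ψ)).aestronglyMeasurable _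
      (Eventually.of_forall fun θ => hb _)
  have hHint2 : ∫ θ, H θ ∂(cubeMeasure E) =
      ∫ θ, (H (θ + φ) + H (θ + -φ)) / 2 ∂(cubeMeasure E) := by
    rw [integral_div, integral_add (hshift φ) (hshift (-φ)),
      integral_cubeMeasure_add hHm hHper, integral_cubeMeasure_add hHm hHper]
    ring
  -- The shifts by φ and -φ agree modulo 2π at f₀, so one lower bound for U serves both.
  have hUm' : ∀ x, U (x - Real.pi) = U (x + Real.pi) := fun x => by
    have h2 := hUper (x - Real.pi) 1
    rw [show x - Real.pi + 2 * Real.pi * ((1 : ℤ) : ℝ) = x + Real.pi by push_cast; ring] at h2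
    exact h2.symm
  set c₁ := Real.exp (-(β / 2) * ∑ f ∈ S, incAngle s φ f ^ 2) with hc₁
  set c₂ := Real.exp (-(β * Real.pi ^ 2 / 2) - β * ε) / 4 with hc₂
  have hpt : ∀ θ, c₁ * c₂ * (weightProd s β S θ * villainWeight γ (incAngle s θ f₀)) ≤
      (H (θ + φ) + H (θ + -φ)) / 2 := fun θ => by
    simp only [hH, incAngle_add, incAngle_neg, hφ, ← sub_eq_add_neg (incAngle s θ f₀), hUm']
    have h1 := exp_mul_weightProd_le s hβ S θ φ
    have h2 := mul_le_mul h1 (hUlow (incAngle s θ f₀))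
      (mul_nonneg (by positivity) (villainWeight_pos hγ0 _).le)
      (le_trans (mul_nonneg (Real.exp_pos _).le (weightProd_pos s hβ S θ).le) h1)
    calc _ = _ := by ring
      _ ≤ _ := h2
      _ = _ := by ring
  have hWint := integrable_weightProd_mul s hβ S
    ((measurable_villainWeight γ).comp (measurable_incAngle s f₀))
    (fun θ => abs_villainWeight_le hγ0 (incAngle s θ f₀))
  have hmain : c₁ * c₂ * ∫ θ, weightProd s β S θ * villainWeight γ (incAngle s θ f₀)
      ∂(cubeMeasure E) ≤ ∫ θ, H θ ∂(cubeMeasure E) := by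
    rw [hHint2, ← integral_const_mul]
    exact integral_mono (hWint.const_mul _) (((hshift φ).add (hshift (-φ))).div_const 2) hpt
  have hcomp := sqrt_mul_integral_le s hβ hγ1 S f₀
  have hratio : β / γ = (1 + Real.pi ^ 2 / (2 * ε))⁻¹ := by
    rw [hγ]; field_simp
  rw [hratio] at hcomp
  -- The factor exp(-βπ²/2) from the face f₀ is exactly its missing share of the energy of φ.
  have hLHS : Real.exp (-(β / 2) * ∑ f, incAngle s φ f ^ 2 - β * ε) / 4 = c₁ * c₂ := by
    rw [hc₁, hc₂, ← mul_div_assoc, ← Real.exp_add]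
    congr 2
    rw [← Finset.sum_erase_add _ _ (Finset.mem_univ f₀), hφ, ← hS]
    ring
  have hRHS : ∀ θ, weightProd s β Finset.univ θ *
      villainVar β (((σ : ℤ) : ℝ) * incAngle s θ f₀) = H θ := fun θ => by
    rw [hprod, mul_assoc]
  simp only [hRHS]
  refine le_trans ?_ hmain
  simp only [hprod]
  calc _ = Real.exp (-(β / 2) * ∑ f, incAngle s φ f ^ 2 - β * ε) / 4 *
        (Real.sqrt (1 + Real.pi ^ 2 / (2 * ε))⁻¹ * ∫ θ, weightProd s β S θ *
          villainWeight β (incAngle s θ f₀) ∂(cubeMeasure E)) := by ring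
    _ ≤ _ := by
      rw [hLHS]
      exact mul_le_mul_of_nonneg_left hcomp (by positivity)

end Incidence

/-! ### Summation over the integer variables -/

section Incidence

variable {E F : Type*} [Fintype E] [Fintype F]

lemma pi_count_int : (Measure.pi fun _ : F => (Measure.count : Measure ℤ)) = Measure.count := by
  refine Measure.ext_of_singleton fun m => ?_
  rw [Measure.pi_singleton]
  simp

lemma integrable_gaussTerm {β : ℝ} (hβ : 0 < β) (x : ℝ) :
    Integrable (gaussTerm β x) (Measure.count : Measure ℤ) :=
  integrable_count_iff.2 (summable_gaussTerm hβ x).norm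

lemma integral_gaussTerm {β : ℝ} (hβ : 0 < β) (x : ℝ) :
    ∫ k, gaussTerm β x k ∂(Measure.count : Measure ℤ) = villainWeight β x := by
  rw [integral_countable (integrable_gaussTerm hβ x)]
  simp [Measure.real, villainWeight]

lemma integrable_prod_gaussTerm {β : ℝ} (hβ : 0 < β) (x : F → ℝ) :
    Integrable (fun m : F → ℤ => ∏ f, gaussTerm β (x f) (m f)) Measure.count := by
  rw [← pi_count_int]
  exact Integrable.fintype_prod fun f => integrable_gaussTerm hβ (x f)

lemma integral_prod_gaussTerm {β : ℝ} (hβ : 0 < β) (x : F → ℝ) :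
    ∫ m : F → ℤ, ∏ f, gaussTerm β (x f) (m f) ∂Measure.count = ∏ f, villainWeight β (x f) := by
  rw [← pi_count_int, integral_fintype_prod_eq_prod (f := fun f => gaussTerm β (x f))]
  simp only [integral_gaussTerm hβ]

/-- The joint density of angles and integer variables. -/
def jointDensity (s : F → E → ℤ) (β : ℝ) (p : (E → ℝ) × (F → ℤ)) : ℝ :=
  ∏ f, gaussTerm β (incAngle s p.1 f) (p.2 f)

lemma jointDensity_pos (s : F → E → ℤ) (β : ℝ) (p : (E → ℝ) × (F → ℤ)) :
    0 < jointDensity s β p :=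
  Finset.prod_pos fun _ _ => gaussTerm_pos _ _ _

lemma measurable_jointDensity (s : F → E → ℤ) (β : ℝ) : Measurable (jointDensity s β) := by
  refine Finset.measurable_fun_prod _ fun f _ => ?_
  unfold gaussTerm
  have h1 : Measurable fun p : (E → ℝ) × (F → ℤ) => incAngle s p.1 f :=
    (measurable_incAngle s f).comp measurable_fst
  have h2 : Measurable fun p : (E → ℝ) × (F → ℤ) => ((p.2 f : ℤ) : ℝ) :=
    (measurable_of_countable _).comp ((measurable_pi_apply f).comp measurable_snd)
  fun_prop

lemma integral_jointDensity {s : F → E → ℤ} {β : ℝ} (hβ : 0 < β) {g : (E → ℝ) → ℝ}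
    (hg : Measurable g)
    (hint : Integrable (fun θ => weightProd s β Finset.univ θ * g θ) (cubeMeasure E)) :
    ∫ p, g p.1 ∂(((cubeMeasure E).prod (Measure.count : Measure (F → ℤ))).withDensity
        fun p => ENNReal.ofReal (jointDensity s β p)) =
      ∫ θ, weightProd s β Finset.univ θ * g θ ∂(cubeMeasure E) := by
  rw [integral_withDensity_eq_integral_toReal_smul
    (measurable_jointDensity s β).ennreal_ofReal (by simp)]
  simp only [ENNReal.toReal_ofReal (jointDensity_pos s β _).le, smul_eq_mul]
  have hm : Measurable fun p : (E → ℝ) × (F → ℤ) => jointDensity s β p * g p.1 :=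
    (measurable_jointDensity s β).mul (hg.comp measurable_fst)
  have hI : Integrable (fun p : (E → ℝ) × (F → ℤ) => jointDensity s β p * g p.1)
      ((cubeMeasure E).prod Measure.count) := by
    rw [integrable_prod_iff hm.aestronglyMeasurable]
    refine ⟨Eventually.of_forall fun θ => ?_, ?_⟩
    · exact (integrable_prod_gaussTerm hβ fun f => incAngle s θ f).mul_const (g θ)
    · refine hint.norm.congr (Eventually.of_forall fun θ => ?_)
      simp only [norm_mul, Real.norm_of_nonneg (jointDensity_pos s β _).le, integral_mul_const,
        Real.norm_of_nonneg (weightProd_pos s hβ _ θ).le]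
      simp only [jointDensity]
      rw [integral_prod_gaussTerm hβ fun f => incAngle s θ f, weightProd]
  rw [integral_prod _ hI]
  refine integral_congr_ae (Eventually.of_forall fun θ => ?_)
  simp only [integral_mul_const, jointDensity]
  rw [integral_prod_gaussTerm hβ fun f => incAngle s θ f, weightProd]

lemma integrable_weightProd (s : F → E → ℤ) {β : ℝ} (hβ : 0 < β) :
    Integrable (weightProd s β Finset.univ) (cubeMeasure E) := by
  simpa using integrable_weightProd_mul s hβ Finset.univ (u := fun _ => 1) measurable_const
    (C := 1) (by simp)

lemma integral_weightProd_pos (s : F → E → ℤ) {β : ℝ} (hβ : 0 < β) :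
    0 < ∫ θ, weightProd s β Finset.univ θ ∂(cubeMeasure E) := by
  rw [integral_pos_iff_support_of_nonneg (fun θ => (weightProd_pos s hβ _ θ).le)
    (integrable_weightProd s hβ)]
  have : Function.support (weightProd s β Finset.univ) = Set.univ :=
    Set.eq_univ_of_forall fun θ => (weightProd_pos s hβ _ θ).ne'
  rw [this]
  exact Measure.measure_univ_pos.2 (cubeMeasure_ne_zero E)

lemma integrable_weightProd_mul_villainVar [DecidableEq F] (s : F → E → ℤ) {β : ℝ} (hβ : 0 < β)
    (σ : ℤˣ) (f₀ : F) : Integrable (fun θ => weightProd s β Finset.univ θ *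
      villainVar β (((σ : ℤ) : ℝ) * incAngle s θ f₀)) (cubeMeasure E) := by
  have hm : Measurable fun x => villainWeight β x * villainVar β (((σ : ℤ) : ℝ) * x) :=
    (measurable_villainWeight β).mul ((measurable_villainVar hβ).comp (measurable_const_mul _))
  have h := integrable_weightProd_mul s hβ (Finset.univ.erase f₀)
    (hm.comp (measurable_incAngle s f₀)) (C := β⁻¹ * ∑' n : ℤ, villainCoeff (β / 2) n)
    fun θ => by
      have h0 : villainWeight β (incAngle s θ f₀) =
          villainWeight β (((σ : ℤ) : ℝ) * incAngle s θ f₀) := by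
        rcases Int.units_eq_one_or σ with h | h <;> simp [h, villainWeight_neg]
      simp only [Function.comp_def]
      rw [h0, abs_of_nonneg (mul_nonneg (villainWeight_pos hβ _).le (villainVar_nonneg _ _))]
      exact (villainWeight_mul_villainVar_le hβ _).trans
        (mul_le_mul_of_nonneg_left (villainWeight_le (half_pos hβ) _) (by positivity))
  refine h.congr (Eventually.of_forall fun θ => ?_)
  simp only [Function.comp_def]
  rw [← mul_assoc, weightProd, weightProd, Finset.prod_erase_mul _ _ (Finset.mem_univ f₀)]

lemma integral_normalize {α : Type*} [MeasurableSpace α] (μ : Measure α) (g : α → ℝ) :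
    ∫ x, g x ∂(normalize μ) = (∫ x, g x ∂μ) / ∫ _, (1 : ℝ) ∂μ := by
  rw [normalize, integral_smul_measure]
  simp [Measure.real, div_eq_inv_mul]

end Incidence

/-! ### The incidence matrix of the box -/

/-- The coefficient of the edge `e` in the boundary of the cell `w`. -/
def boxIncidence {n k : ℕ} {bc : BC} {j : ℕ} (w : Cell n (k + 1)) (e : BoxCell n k bc j) : ℤ :=
  open Classical in
  ∑ ε : Fin 2, ∑ l : Fin (k + 1),
    (-1) ^ ((ε : ℕ) + ((l : ℕ) + 1)) * if e.1 = w.face l ε then 1 else 0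

lemma extendZero_coe {n k : ℕ} {bc : BC} {j : ℕ} {R : Type*} [Zero R]
    (ω : BoxCell n k bc j → R) (w : BoxCell n k bc j) : extendZero ω w.1 = ω w :=
  dif_pos w.2

lemma extendZero_of_not_mem {n k : ℕ} {bc : BC} {j : ℕ} {R : Type*} [Zero R]
    (ω : BoxCell n k bc j → R) {w : Cell n k}
    (h : ¬(w.InBox j ∧ (bc = BC.zero → ¬ w.OnBoundary j))) : extendZero ω w = 0 :=
  dif_neg h

lemma extendZero_eq_sum {n k : ℕ} {bc : BC} {j : ℕ} (ω : BoxCell n k bc j → ℝ) (w : Cell n k) :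
    extendZero ω w = open Classical in ∑ e, if e.1 = w then ω e else 0 := by
  classical
  by_cases h : w.InBox j ∧ (bc = BC.zero → ¬ w.OnBoundary j)
  · obtain ⟨e, rfl⟩ : ∃ e : BoxCell n k bc j, e.1 = w := ⟨⟨w, h⟩, rfl⟩
    rw [extendZero_coe, Finset.sum_eq_single e]
    · simp
    · intro e' _ he
      rw [if_neg fun h' => he (Subtype.ext h')]
    · simp
  · rw [extendZero_of_not_mem ω h]
    refine (Finset.sum_eq_zero fun e _ => ?_).symm
    rw [if_neg]
    rintro rfl
    exact h e.2

lemma extDeriv_extendZero {n k : ℕ} {bc : BC} {j : ℕ} (ω : BoxCell n k bc j → ℝ)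
    (w : Cell n (k + 1)) :
    extDeriv (extendZero ω) w = ∑ e, (boxIncidence w e : ℝ) * ω e := by
  classical
  simp only [extDeriv, extendZero_eq_sum, boxIncidence, Finset.mul_sum]
  push_cast
  simp only [Finset.sum_mul]
  rw [Finset.sum_comm (s := (Finset.univ : Finset (BoxCell n k bc j)))]
  refine Finset.sum_congr rfl fun ε _ => ?_
  rw [Finset.sum_comm (s := (Finset.univ : Finset (BoxCell n k bc j)))]
  refine Finset.sum_congr rfl fun l _ => Finset.sum_congr rfl fun e _ => ?_
  split_ifs <;> simp

lemma Cell.OnBoundary.face {n k : ℕ} {w : Cell n (k + 1)} {j : ℕ} (h : w.OnBoundary j)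
    (l : Fin (k + 1)) (ε : Fin 2) : (w.face l ε).OnBoundary j := by
  obtain ⟨i, hi, hb⟩ := h
  refine ⟨i, ?_, ?_⟩
  · rintro ⟨m, hm⟩
    exact hi ⟨_, hm⟩
  · have hne : i ≠ w.dir l := fun h => hi ⟨l, h.symm⟩
    have : (w.face l ε).base i = w.base i := by
      simp only [Cell.face, Pi.add_apply]
      split_ifs <;> simp [hne]
    rwa [this]

lemma extendZero_of_onBoundary {n k j : ℕ} {R : Type*} [Zero R]
    (ω : BoxCell n k BC.zero j → R) {w : Cell n k} (h : w.OnBoundary j) : extendZero ω w = 0 :=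
  extendZero_of_not_mem ω fun h' => h'.2 rfl h

lemma extDeriv_extendZero_of_onBoundary {n k j : ℕ} (ω : BoxCell n k BC.zero j → ℝ)
    {w : Cell n (k + 1)} (h : w.OnBoundary j) : extDeriv (extendZero ω) w = 0 := by
  unfold extDeriv
  refine Finset.sum_eq_zero fun ε _ => Finset.sum_eq_zero fun l _ => ?_
  rw [extendZero_of_onBoundary ω (h.face l ε), mul_zero]

/-- A cell of the box, seen as a cell of the box with free boundary condition. -/
def BoxCell.toFree {n k : ℕ} {bc : BC} {j : ℕ} (w : BoxCell n k bc j) : BoxCell n k BC.free j :=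
  ⟨w.1, w.2.1, by simp⟩

lemma sum_boxCell_eq {n k j : ℕ} (bc : BC) (g : Cell n k → ℝ)
    (hg : bc = BC.zero → ∀ w, w.OnBoundary j → g w = 0) :
    ∑ w : BoxCell n k bc j, g w.1 = ∑ w : BoxCell n k BC.free j, g w.1 := by
  refine Fintype.sum_of_injective (BoxCell.toFree (n := n) (k := k) (bc := bc) (j := j))
    (fun v w h => Subtype.ext (congrArg Subtype.val h :)) _ _ (fun w hw => ?_) (fun w => rfl)
  by_contra h
  exact hw ⟨⟨w.1, w.2.1, fun hz hb => h (hg hz _ hb)⟩, rfl⟩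

/-- With the zero condition, a face in the boundary has all its edges in the boundary, so dθ and m
both vanish there and only the faces carrying an integer variable contribute. -/
lemma exp_energy_eq {bc : BC} {j : ℕ} (β : ℝ) (p : Config bc j) :
    Real.exp (-(β / 2) * energy p) =
      jointDensity (fun (f : BoxCell 4 2 bc j) e => boxIncidence f.1 e) β p := by
  have h := sum_boxCell_eq (j := j) bc (fun f : Cell 4 2 =>
    (dTheta p f + 2 * Real.pi * ((extendZero p.2 f : ℤ) : ℝ)) ^ 2) (by
      rintro rfl w hw
      simp only [dTheta, extDeriv_extendZero_of_onBoundary _ hw, extendZero_of_onBoundary _ hw]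
      simp)
  rw [energy, ← h, Finset.mul_sum, Real.exp_sum, jointDensity]
  refine Finset.prod_congr rfl fun f _ => ?_
  rw [gaussTerm, dTheta, extDeriv_extendZero, extendZero_coe, incAngle]

/-- `M̃` as a ratio of integrals over the angles. -/
lemma tildeM_eq {bc : BC} {j : ℕ} {β : ℝ} (hβ : 0 < β) (f : OrientedCell 4 2)
    (f₀ : BoxCell 4 2 bc j) (hf : f₀.1 = f.cell) :
    tildeM bc j β f =
      (∫ θ, weightProd (fun (f : BoxCell 4 2 bc j) e => boxIncidence f.1 e) β Finset.univ θ *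
        villainVar β (((f.sign : ℤ) : ℝ) * incAngle (fun (f : BoxCell 4 2 bc j)
          (e : BoxCell 4 1 bc j) => boxIncidence f.1 e) θ f₀) ∂(cubeMeasure (BoxCell 4 1 bc j))) /
      ∫ θ, weightProd (fun (f : BoxCell 4 2 bc j) e => boxIncidence f.1 e) β Finset.univ θ
        ∂(cubeMeasure (BoxCell 4 1 bc j)) := by
  classical
  set s := fun (f : BoxCell 4 2 bc j) (e : BoxCell 4 1 bc j) => boxIncidence f.1 e with hs
  have hV : ∀ p : Config bc j, varIG (-orientedValue (dTheta p) f / (2 * Real.pi))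
      ((2 * Real.pi) ^ 2 * β) = villainVar β (((f.sign : ℤ) : ℝ) * incAngle s p.1 f₀) :=
    fun p => by
      rw [villainVar, orientedValue, dTheta, extDeriv_extendZero, ← hf, incAngle]
  unfold tildeM
  simp only [hV]
  have hvil : villain bc j β = normalize (((cubeMeasure (BoxCell 4 1 bc j)).prod
      (Measure.count : Measure (BoxCell 4 2 bc j → ℤ))).withDensity
        fun p => ENNReal.ofReal (jointDensity s β p)) := by
    unfold villain
    simp only [exp_energy_eq]
    rfl
  rw [hvil, integral_normalize]
  rw [integral_jointDensity hβ (g := fun θ => villainVar β (((f.sign : ℤ) : ℝ) * incAngle s θ f₀))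
    ((measurable_villainVar hβ).comp ((measurable_incAngle s f₀).const_mul _))
    (integrable_weightProd_mul_villainVar s hβ f.sign f₀)]
  rw [integral_jointDensity hβ (g := fun _ => 1) measurable_const
    (by simpa using integrable_weightProd s hβ)]
  simp

/-- The lower bound for `M̃` at `f` in terms of the energy of a form `φ` on the box such that
`dφ(f) = π`. -/
theorem le_tildeM {bc : BC} {j : ℕ} {β ε : ℝ} (hβ : 0 < β) (hε : 0 < ε) (f : OrientedCell 4 2)
    (f₀ : BoxCell 4 2 bc j) (hf : f₀.1 = f.cell) (φ : BoxCell 4 1 bc j → ℝ)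
    (hφ : extDeriv (extendZero φ) f.cell = Real.pi) :
    Real.exp (-(β / 2) * ∑ w : BoxCell 4 2 bc j, extDeriv (extendZero φ) w.1 ^ 2 - β * ε) *
        (Real.sqrt (1 + Real.pi ^ 2 / (2 * ε))⁻¹ / 4) ≤ tildeM bc j β f := by
  classical
  rw [tildeM_eq hβ f f₀ hf, le_div_iff₀ (integral_weightProd_pos _ hβ)]
  simp only [extDeriv_extendZero] at hφ ⊢
  exact le_integral_villainVar (fun (f : BoxCell 4 2 bc j) (e : BoxCell 4 1 bc j) =>
    boxIncidence f.1 e) hβ hε f.sign f₀ φ (by rw [incAngle, hf, hφ])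

/-! ### Exact forms concentrated on one face -/

/-- A subspace of dimension `D` of `ℝ^ι` contains a vector with a coordinate equal to `1` whose
squared norm is at most `|ι| / D`. -/
lemma exists_mem_apply_eq_one {ι : Type*} [Fintype ι] (V : Submodule ℝ (EuclideanSpace ℝ ι))
    (hV : 0 < Module.finrank ℝ V) :
    ∃ f, ∃ v ∈ V, v f = 1 ∧ ‖v‖ ^ 2 ≤ (Fintype.card ι : ℝ) / Module.finrank ℝ V := by
  classical
  set D := Module.finrank ℝ V with hD
  set b := stdOrthonormalBasis ℝ V with hb
  -- The trace of the orthogonal projection onto V is D; some diagonal entry p is at least the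
  -- average D / |ι|.
  have hsum : ∑ f, ∑ i, ((b i : EuclideanSpace ℝ ι) f) ^ 2 = D := by
    rw [Finset.sum_comm]
    have h1 : ∀ i, ∑ f, ((b i : EuclideanSpace ℝ ι) f) ^ 2 = 1 := fun i => by
      rw [← EuclideanSpace.real_norm_sq_eq]
      have : ‖(b i : EuclideanSpace ℝ ι)‖ = 1 := b.orthonormal.1 i
      rw [this, one_pow]
    simp [h1, hD]
  have hne : (Finset.univ : Finset ι).Nonempty := by
    rw [Finset.nonempty_iff_ne_empty]
    intro h
    rw [h, Finset.sum_empty] at hsum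
    exact hV.ne (by exact_mod_cast hsum)
  have hcard : (0 : ℝ) < Fintype.card ι := by
    exact_mod_cast Finset.card_pos.2 hne
  obtain ⟨f, -, hf⟩ := Finset.exists_le_of_sum_le hne
    (f := fun _ => (D : ℝ) / Fintype.card ι)
    (g := fun f => ∑ i, ((b i : EuclideanSpace ℝ ι) f) ^ 2) (by
      rw [hsum, Finset.sum_const, nsmul_eq_mul, Finset.card_univ, mul_div_cancel₀ _ hcard.ne'])
  set p := ∑ i, ((b i : EuclideanSpace ℝ ι) f) ^ 2 with hp
  have hDpos : (0 : ℝ) < D := by exact_mod_cast hV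
  have hp0 : 0 < p := lt_of_lt_of_le (by positivity) hf
  -- This is the projection of the basis vector at f, with u f = ‖u‖² = p; hence u / p has squared
  -- norm 1 / p.
  set u : V := ∑ i, ((b i : EuclideanSpace ℝ ι) f) • b i with hu
  have hu1 : (u : EuclideanSpace ℝ ι) f = p := by
    rw [hu, hp]
    simp [sq]
  have hu2 : ‖(u : EuclideanSpace ℝ ι)‖ ^ 2 = p := by
    change ‖u‖ ^ 2 = p
    rw [← real_inner_self_eq_norm_sq, hu, b.orthonormal.inner_sum]
    simp [hp, sq]
  refine ⟨f, p⁻¹ • (u : EuclideanSpace ℝ ι), V.smul_mem _ u.2, ?_, ?_⟩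
  · simp [hu1, hp0.ne']
  · rw [norm_smul, mul_pow, hu2, Real.norm_of_nonneg (by positivity),
      show p⁻¹ ^ 2 * p = p⁻¹ by field_simp, inv_le_comm₀ hp0 (by positivity), inv_div]
    exact hf

/-- The exterior derivative of the `1`-form with components `a i`, in the directions `i`, `j`. -/
def curl {n : ℕ} (a : Fin n → (Fin n → ℤ) → ℝ) (i j : Fin n) (x : Fin n → ℤ) : ℝ :=
  a i x - a i (x + Pi.single j 1) + a j (x + Pi.single i 1) - a j x

lemma curl_self {n : ℕ} (a : Fin n → (Fin n → ℤ) → ℝ) (i : Fin n) (x : Fin n → ℤ) :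
    curl a i i x = 0 := by
  unfold curl; ring

lemma curl_comm {n : ℕ} (a : Fin n → (Fin n → ℤ) → ℝ) (i j : Fin n) (x : Fin n → ℤ) :
    curl a j i x = -curl a i j x := by
  unfold curl; ring

/-- The cube `[0, N - 1]⁴`. -/
def edgeBox (N : ℕ) : Finset (Fin 4 → ℤ) := Finset.Icc 0 fun _ => (N : ℤ) - 1

/-- The cube `[-1, N - 1]⁴`. -/
def faceBox (N : ℕ) : Finset (Fin 4 → ℤ) := Finset.Icc (fun _ => -1) fun _ => (N : ℤ) - 1

lemma mem_edgeBox {N : ℕ} {x : Fin 4 → ℤ} : x ∈ edgeBox N ↔ ∀ i, 0 ≤ x i ∧ x i ≤ N - 1 := by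
  simp [edgeBox, Pi.le_def, forall_and]

lemma mem_faceBox {N : ℕ} {x : Fin 4 → ℤ} : x ∈ faceBox N ↔ ∀ i, -1 ≤ x i ∧ x i ≤ N - 1 := by
  simp [faceBox, Pi.le_def, forall_and]

lemma card_edgeBox (N : ℕ) : (edgeBox N).card = N ^ 4 := by
  simp [edgeBox, Pi.card_Icc]

lemma card_faceBox (N : ℕ) : (faceBox N).card = (N + 1) ^ 4 := by
  simp only [faceBox, Pi.card_Icc, Int.card_Icc, Finset.prod_const, Finset.card_univ,
    Fintype.card_fin]
  congr 1
  omega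

/-- The edges with base point in `[0, N - 1]⁴` that are not in the direction `0`. -/
abbrev GaugeEdge (N : ℕ) : Type := {i : Fin 4 // i ≠ 0} × edgeBox N

/-- The faces that can meet one of these edges, with both orientations. -/
abbrev GaugeFace (N : ℕ) : Type := {p : Fin 4 × Fin 4 // p.1 ≠ p.2} × faceBox N

/-- The components of the `1`-form with the given values, zero outside. -/
def gaugeField (N : ℕ) : (GaugeEdge N → ℝ) →ₗ[ℝ] (Fin 4 → (Fin 4 → ℤ) → ℝ) where
  toFun c i x := if h : i ≠ 0 ∧ x ∈ edgeBox N then c (⟨i, h.1⟩, ⟨x, h.2⟩) else 0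
  map_add' c c' := by
    funext i x
    simp only [Pi.add_apply]
    split_ifs <;> simp
  map_smul' r c := by
    funext i x
    simp only [Pi.smul_apply, RingHom.id_apply]
    split_ifs <;> simp

lemma gaugeField_apply_of_not_mem {N : ℕ} (c : GaugeEdge N → ℝ) (i : Fin 4) {x : Fin 4 → ℤ}
    (h : x ∉ edgeBox N) : gaugeField N c i x = 0 :=
  dif_neg fun h' => h h'.2

lemma gaugeField_zero_apply {N : ℕ} (c : GaugeEdge N → ℝ) (x : Fin 4 → ℤ) :
    gaugeField N c 0 x = 0 := by
  simp [gaugeField]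

/-- The exterior derivative from `GaugeEdge` to `GaugeFace`. -/
def gaugeCurl (N : ℕ) : (GaugeEdge N → ℝ) →ₗ[ℝ] EuclideanSpace ℝ (GaugeFace N) where
  toFun c := WithLp.toLp 2 fun q => curl (gaugeField N c) q.1.1.1 q.1.1.2 q.2.1
  map_add' c c' := by
    ext q
    simp only [map_add, curl, Pi.add_apply, PiLp.add_apply]
    ring
  map_smul' r c := by
    ext q
    simp only [map_smul, curl, Pi.smul_apply, PiLp.smul_apply, smul_eq_mul, RingHom.id_apply]
    ring

/-- Axial gauge: with the component in direction 0 absent, the curl in directions (0, i) is the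
increment of the i-th component along direction 0. If it vanishes, that component is constant along
lines that start outside the support. -/
lemma gaugeCurl_injective (N : ℕ) : Function.Injective (gaugeCurl N) := by
  rw [injective_iff_map_eq_zero]
  intro c hc
  have hcurl : ∀ i : Fin 4, i ≠ 0 → ∀ x ∈ faceBox N,
      gaugeField N c i (x + Pi.single 0 1) = gaugeField N c i x := fun i hi x hx => by
    have h := congrArg (fun v : EuclideanSpace ℝ (GaugeFace N) =>
      v (⟨(0, i), hi.symm⟩, ⟨x, hx⟩)) hc
    simp only [gaugeCurl, LinearMap.coe_mk, AddHom.coe_mk, curl, gaugeField_zero_apply,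
      PiLp.zero_apply] at h
    linarith
  -- The induction starts on the layer x 0 = -1, just outside the edges; this is why `faceBox`
  -- begins at -1.
  have hzero : ∀ i : Fin 4, i ≠ 0 → ∀ n : ℕ, ∀ x : Fin 4 → ℤ, x 0 = (n : ℤ) - 1 →
      gaugeField N c i x = 0 := by
    intro i hi n
    induction n with
    | zero =>
      intro x hx
      refine gaugeField_apply_of_not_mem c i fun h => ?_
      have := (mem_edgeBox.1 h 0).1
      simp at hx
      omega
    | succ n ih =>
      intro x hx
      by_cases h : x ∈ edgeBox N
      · have hx' : x - Pi.single 0 1 ∈ faceBox N := by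
          rw [mem_faceBox]
          intro m
          have := mem_edgeBox.1 h m
          rcases eq_or_ne m 0 with rfl | hm
          · simp only [Pi.sub_apply, Pi.single_eq_same]; omega
          · simp only [Pi.sub_apply, Pi.single_eq_of_ne hm]; omega
        have h1 := hcurl i hi _ hx'
        rw [sub_add_cancel] at h1
        rw [h1]
        refine ih _ ?_
        simp only [Pi.sub_apply, Pi.single_eq_same, hx]
        push_cast
        ring
      · exact gaugeField_apply_of_not_mem c i h
  funext e
  obtain ⟨⟨i, hi⟩, ⟨x, hx⟩⟩ := e
  have h0 := (mem_edgeBox.1 hx 0).1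
  have h1 := hzero i hi (x 0 + 1).toNat x (by rw [Int.toNat_of_nonneg (by omega)]; ring)
  have h2 : gaugeField N c i x = c (⟨i, hi⟩, ⟨x, hx⟩) := dif_pos ⟨hi, hx⟩
  rw [← h2, h1]
  rfl

lemma curl_gaugeField_of_not_mem {N : ℕ} (c : GaugeEdge N → ℝ) (i j : Fin 4) {x : Fin 4 → ℤ}
    (h : x ∉ faceBox N) : curl (gaugeField N c) i j x = 0 := by
  have h1 : x ∉ edgeBox N := fun h' => h <| mem_faceBox.2 fun m => by
    have := mem_edgeBox.1 h' m; omega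
  have h2 : ∀ k : Fin 4, x + Pi.single k 1 ∉ edgeBox N := fun k h' => h <| mem_faceBox.2 fun m => by
    have := mem_edgeBox.1 h' m
    rcases eq_or_ne m k with rfl | hm
    · simp only [Pi.add_apply, Pi.single_eq_same] at this; omega
    · simp only [Pi.add_apply, Pi.single_eq_of_ne hm] at this; omega
  simp [curl, gaugeField_apply_of_not_mem, h1, h2]

lemma sum_curl_sq_le {N : ℕ} (c : GaugeEdge N → ℝ) (S : Finset (Fin 4 → ℤ)) :
    ∑ x ∈ S, ∑ i, ∑ j, curl (gaugeField N c) i j x ^ 2 ≤ ‖gaugeCurl N c‖ ^ 2 := by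
  classical
  have h1 : ∑ x ∈ S, ∑ i, ∑ j, curl (gaugeField N c) i j x ^ 2 ≤
      ∑ x ∈ faceBox N, ∑ i, ∑ j, curl (gaugeField N c) i j x ^ 2 := by
    refine (Finset.sum_le_sum_of_subset_of_nonneg (Finset.subset_union_left (s₂ := faceBox N))
      fun x _ _ => Finset.sum_nonneg fun i _ => Finset.sum_nonneg fun j _ => sq_nonneg _).trans
      (le_of_eq (Finset.sum_subset Finset.subset_union_right fun x _ hx => ?_).symm)
    simp [curl_gaugeField_of_not_mem c _ _ hx]
  refine h1.trans (le_of_eq ?_)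
  rw [EuclideanSpace.real_norm_sq_eq, Fintype.sum_prod_type_right,
    ← Finset.sum_coe_sort]
  refine Finset.sum_congr rfl fun x _ => ?_
  rw [← Fintype.sum_prod_type' (f := fun i j => curl (gaugeField N c) i j x.1 ^ 2)]
  refine (Fintype.sum_of_injective Subtype.val Subtype.val_injective _ _ (fun p hp => ?_)
    fun p => rfl).symm
  have : p.1 = p.2 := by
    by_contra h
    exact hp ⟨⟨p, h⟩, rfl⟩
  rw [this, curl_self]
  simp

/-- A finitely supported `1`-form whose exterior derivative carries at one face almost half of its
energy, which is `1/4` in terms of the sum over ordered pairs of directions. -/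
lemma exists_curl_eq_one {η : ℝ} (hη : 0 < η) :
    ∃ (a : Fin 4 → (Fin 4 → ℤ) → ℝ) (R : ℤ) (i₀ j₀ : Fin 4) (x₀ : Fin 4 → ℤ), i₀ ≠ j₀ ∧
      (∀ i x, a i x ≠ 0 → ∀ m, |x m - x₀ m| ≤ R) ∧ curl a i₀ j₀ x₀ = 1 ∧
      ∀ S : Finset (Fin 4 → ℤ), ∑ x ∈ S, ∑ i, ∑ j, curl a i j x ^ 2 ≤ 4 * (1 + η) := by
  have hlim : Tendsto (fun N : ℕ => (1 + 1 / (N : ℝ)) ^ 4) atTop (nhds ((1 + 0) ^ 4)) :=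
    (tendsto_const_nhds.add tendsto_one_div_atTop_nhds_zero_nat).pow 4
  have hev : ∀ᶠ N : ℕ in atTop, (1 + 1 / (N : ℝ)) ^ 4 < 1 + η :=
    hlim.eventually_lt_const (by simpa using hη)
  obtain ⟨N, hN, hN1⟩ := (hev.and (eventually_ge_atTop 1)).exists
  have hN0 : (0 : ℝ) < N := by exact_mod_cast hN1
  have hrank : Module.finrank ℝ (LinearMap.range (gaugeCurl N)) = 3 * N ^ 4 := by
    rw [LinearMap.finrank_range_of_inj (gaugeCurl_injective N), Module.finrank_fintype_fun_eq_card,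
      Fintype.card_prod, Fintype.card_coe, card_edgeBox]
    rfl
  have hcard : Fintype.card (GaugeFace N) = 12 * (N + 1) ^ 4 := by
    rw [Fintype.card_prod, Fintype.card_coe, card_faceBox]
    rfl
  -- The ratio 12(N + 1)⁴ / (3N⁴) tends to 4, which is 2 per non-oriented face.
  obtain ⟨q, v, ⟨c, rfl⟩, hv1, hv2⟩ := exists_mem_apply_eq_one (LinearMap.range (gaugeCurl N))
    (by rw [hrank]; positivity)
  have hx₀ := mem_faceBox.1 q.2.2
  refine ⟨gaugeField N c, N, q.1.1.1, q.1.1.2, q.2.1, q.1.2, fun i x hx m => ?_, hv1,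
    fun S => (sum_curl_sq_le c S).trans (hv2.trans ?_)⟩
  · have hx' : x ∈ edgeBox N := by
      by_contra h
      exact hx (gaugeField_apply_of_not_mem c i h)
    have h1 := mem_edgeBox.1 hx' m
    have h2 := hx₀ m
    rw [abs_le]
    constructor <;> omega
  · rw [hrank, hcard]
    push_cast
    have : (12 * ((N : ℝ) + 1) ^ 4) / (3 * (N : ℝ) ^ 4) = 4 * (1 + 1 / (N : ℝ)) ^ 4 := by
      field_simp
      norm_num
    rw [this]
    linarith

/-- The form of `exists_curl_eq_one` can be moved to any face. -/
lemma exists_curl_eq_one_at {η : ℝ} (hη : 0 < η) :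
    ∃ R : ℤ, ∀ (i₁ j₁ : Fin 4) (x₁ : Fin 4 → ℤ), i₁ ≠ j₁ →
      ∃ a : Fin 4 → (Fin 4 → ℤ) → ℝ,
        (∀ i x, a i x ≠ 0 → ∀ m, |x m - x₁ m| ≤ R) ∧ curl a i₁ j₁ x₁ = 1 ∧
        ∀ S : Finset (Fin 4 → ℤ), ∑ x ∈ S, ∑ i, ∑ j, curl a i j x ^ 2 ≤ 4 * (1 + η) := by
  classical
  obtain ⟨a, R, i₀, j₀, x₀, h₀, hR, ha, hS⟩ := exists_curl_eq_one hη
  refine ⟨R, fun i₁ j₁ x₁ h₁ => ?_⟩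
  -- The averaging argument does not choose the face. The sum over ordered pairs of directions is
  -- invariant under permuting the axes, and no orientation sign appears.
  obtain ⟨σ, hσi, hσj⟩ : ∃ σ : Equiv.Perm (Fin 4), σ i₁ = i₀ ∧ σ j₁ = j₀ := by
    refine ⟨Equiv.swap (Equiv.swap i₁ i₀ j₁) j₀ * Equiv.swap i₁ i₀, ?_, by simp⟩
    rw [Equiv.Perm.mul_apply, Equiv.swap_apply_left, Equiv.swap_apply_of_ne_of_ne _ h₀]
    intro h
    have : Equiv.swap i₁ i₀ i₁ = Equiv.swap i₁ i₀ j₁ := by rw [Equiv.swap_apply_left, ← h]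
    exact h₁ ((Equiv.swap i₁ i₀).injective this)
  set T : (Fin 4 → ℤ) → (Fin 4 → ℤ) := fun x m => x (σ.symm m) - x₁ (σ.symm m) + x₀ m with hT
  have hTadd : ∀ x k, T (x + Pi.single k 1) = T x + Pi.single (σ k) 1 := fun x k => by
    funext m
    have : (Pi.single k 1 : Fin 4 → ℤ) (σ.symm m) = (Pi.single (σ k) 1 : Fin 4 → ℤ) m := by
      simp only [Pi.single_apply, Equiv.symm_apply_eq]
    simp only [hT, Pi.add_apply, this]
    ring
  have hTinj : Function.Injective T := fun x y h => by
    funext m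
    have := congrFun h (σ m)
    simpa [hT] using this
  have hTx : T x₁ = x₀ := by funext m; simp [hT]
  have hcurl : ∀ i j x, curl (fun i x => a (σ i) (T x)) i j x = curl a (σ i) (σ j) (T x) :=
    fun i j x => by simp only [curl, hTadd]
  refine ⟨fun i x => a (σ i) (T x), fun i x hx m => ?_, ?_, fun S => ?_⟩
  · have := hR _ _ hx (σ m)
    simpa [hT] using this
  · rw [hcurl, hσi, hσj, hTx, ha]
  · have h := hS (S.image T)
    rw [Finset.sum_image fun x _ y _ h => hTinj h] at h
    refine le_trans (le_of_eq (Finset.sum_congr rfl fun x _ => ?_)) h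
    simp only [hcurl]
    rw [Equiv.sum_comp σ (fun i => ∑ j, curl a i (σ j) (T x) ^ 2)]
    exact Finset.sum_congr rfl fun i _ => Equiv.sum_comp σ (fun j => curl a i j (T x) ^ 2)

/-! ### The test form on the box and the lower bound -/

lemma extDeriv_eq_curl {n : ℕ} (a : Fin n → (Fin n → ℤ) → ℝ) (w : Cell n 2) :
    extDeriv (fun e : Cell n 1 => a (e.dir 0) e.base) w = curl a (w.dir 0) (w.dir 1) w.base := by
  simp [extDeriv, curl, Cell.face, Fin.sum_univ_two, Fin.succAbove]
  ring

lemma two_mul_sum_lt_curl_sq (a : Fin 4 → (Fin 4 → ℤ) → ℝ) (x : Fin 4 → ℤ) :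
    2 * ∑ p : Fin 4 × Fin 4 with p.1 < p.2, curl a p.1 p.2 x ^ 2 =
      ∑ i, ∑ j, curl a i j x ^ 2 := by
  have h : ∀ i j, curl a j i x ^ 2 = curl a i j x ^ 2 := fun i j => by
    rw [curl_comm a i j, neg_sq]
  rw [Finset.sum_filter, Fintype.sum_prod_type]
  simp only [Fin.sum_univ_four, curl_self, h 0 1, h 0 2, h 0 3, h 1 2, h 1 3, h 2 3]
  simp
  ring

lemma two_mul_sum_boxCell_le {bc : BC} {j : ℕ} (a : Fin 4 → (Fin 4 → ℤ) → ℝ) {C : ℝ}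
    (hC : ∀ S : Finset (Fin 4 → ℤ), ∑ x ∈ S, ∑ i, ∑ j, curl a i j x ^ 2 ≤ C) :
    2 * ∑ w : BoxCell 4 2 bc j, curl a (w.1.dir 0) (w.1.dir 1) w.1.base ^ 2 ≤ C := by
  classical
  set S : Finset (Fin 4 → ℤ) := Finset.univ.image fun w : BoxCell 4 2 bc j => w.1.base with hS
  set P : Finset (Fin 4 × Fin 4) := Finset.univ.filter fun p => p.1 < p.2 with hP
  set u : BoxCell 4 2 bc j → (Fin 4 → ℤ) × (Fin 4 × Fin 4) :=
    fun w => (w.1.base, (w.1.dir 0, w.1.dir 1)) with hu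
  have hinj : Function.Injective u := fun v w h => by
    simp only [hu, Prod.mk.injEq] at h
    refine Subtype.ext (Cell.ext h.1 ?_)
    ext l
    fin_cases l
    · exact congrArg Fin.val h.2.1
    · exact congrArg Fin.val h.2.2
  have hsub : Finset.univ.image u ⊆ S ×ˢ P := fun q hq => by
    obtain ⟨w, -, rfl⟩ := Finset.mem_image.1 hq
    rw [Finset.mem_product]
    refine ⟨Finset.mem_image_of_mem _ (Finset.mem_univ w), ?_⟩
    simp [hP, hu]
  calc 2 * ∑ w : BoxCell 4 2 bc j, curl a (w.1.dir 0) (w.1.dir 1) w.1.base ^ 2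
      = 2 * ∑ q ∈ Finset.univ.image u, curl a q.2.1 q.2.2 q.1 ^ 2 := by
        rw [Finset.sum_image fun v _ w _ h => hinj h]
    _ ≤ 2 * ∑ q ∈ S ×ˢ P, curl a q.2.1 q.2.2 q.1 ^ 2 :=
        mul_le_mul_of_nonneg_left
          (Finset.sum_le_sum_of_subset_of_nonneg hsub fun _ _ _ => sq_nonneg _) zero_le_two
    _ = ∑ x ∈ S, ∑ i, ∑ j, curl a i j x ^ 2 := by
        rw [Finset.sum_product, Finset.mul_sum]
        exact Finset.sum_congr rfl fun x _ => two_mul_sum_lt_curl_sq a x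
    _ ≤ C := hC S

lemma Cell.FarFromBoundary.boxCell {n k : ℕ} {w : Cell n k} {j L : ℕ}
    (hw : w.FarFromBoundary j (L + 1)) (bc : BC) :
    w.InBox j ∧ (bc = BC.zero → ¬ w.OnBoundary j) := by
  refine ⟨fun i => ?_, fun _ => ?_⟩
  · have := hw i
    push_cast at this
    omega
  · rintro ⟨i, hi, h⟩
    have := hw i
    rw [if_neg hi] at this
    push_cast at this
    omega

lemma exists_test_form {η : ℝ} (hη : 0 < η) :
    ∃ L : ℕ, ∀ (j : ℕ) (bc : BC) (f : Cell 4 2), f.FarFromBoundary j L →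
      ∃ (f₀ : BoxCell 4 2 bc j) (φ : BoxCell 4 1 bc j → ℝ), f₀.1 = f ∧
        extDeriv (extendZero φ) f = Real.pi ∧
        ∑ w : BoxCell 4 2 bc j, extDeriv (extendZero φ) w.1 ^ 2 ≤
          2 * Real.pi ^ 2 * (1 + η) := by
  classical
  obtain ⟨R, hR⟩ := exists_curl_eq_one_at hη
  -- The margin is R for the support, one for the length of an edge, and one to keep the edges off
  -- the boundary.
  refine ⟨R.toNat + 1 + 1, fun j bc f hf => ?_⟩
  obtain ⟨a, ha, ha1, haS⟩ := hR (f.dir 0) (f.dir 1) f.base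
    (fun h => by simpa using f.dir.injective h)
  set φ : BoxCell 4 1 bc j → ℝ := fun e => Real.pi * a (e.1.dir 0) e.1.base with hφ
  have hext : extendZero φ = fun e : Cell 4 1 => (fun i x => Real.pi * a i x) (e.dir 0) e.base := by
    funext e
    by_cases he : a (e.dir 0) e.base = 0
    · rw [extendZero]
      split_ifs <;> simp [hφ, he]
    · have h1 := ha _ _ he
      have h2 : e.FarFromBoundary j (0 + 1) := fun i => by
        have h3 := hf i
        have h4 := abs_le.1 (h1 i)
        have h5 := Int.self_le_toNat R
        push_cast at h3 ⊢
        constructor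
        · split_ifs at h3 <;> omega
        · split_ifs at h3 ⊢ <;> omega
      exact extendZero_coe φ ⟨e, h2.boxCell bc⟩
  have hcurl : ∀ i j x, curl (fun i x => Real.pi * a i x) i j x = Real.pi * curl a i j x :=
    fun i j x => by unfold curl; ring
  have hd : ∀ w : Cell 4 2, extDeriv (extendZero φ) w =
      Real.pi * curl a (w.dir 0) (w.dir 1) w.base := fun w => by
    rw [hext]
    exact (extDeriv_eq_curl (fun i x => Real.pi * a i x) w).trans (hcurl _ _ _)
  refine ⟨⟨f, hf.boxCell bc⟩, φ, rfl, ?_, ?_⟩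
  · rw [hd, ha1, mul_one]
  · simp only [hd, mul_pow, ← Finset.mul_sum]
    have := two_mul_sum_boxCell_le (bc := bc) (j := j) a haS
    nlinarith [sq_nonneg Real.pi]

lemma exists_exp_le_tildeM {δ : ℝ} (hδ : 0 < δ) :
    ∃ β₀ : ℝ, 0 < β₀ ∧ ∃ L : ℕ, ∀ β : ℝ, β₀ ≤ β → ∀ (j : ℕ) (bc : BC) (f : OrientedCell 4 2),
      f.cell.FarFromBoundary j L →
        Real.exp (-(Real.pi ^ 2 * β * (1 + δ))) ≤ tildeM bc j β f := by
  have hpi : 0 < Real.pi ^ 2 := by positivity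
  -- Of the slack π²βδ, a quarter pays for βε, a quarter for the excess energy η = δ/4, and the
  -- remaining half for the constant c once β is large.
  set ε := Real.pi ^ 2 * δ / 4 with hε
  have hε0 : 0 < ε := by positivity
  set c := Real.sqrt (1 + Real.pi ^ 2 / (2 * ε))⁻¹ / 4 with hc
  have hc0 : 0 < c := by positivity
  obtain ⟨L, hL⟩ := exists_test_form (η := δ / 4) (by positivity)
  refine ⟨max 1 (-Real.log c / (Real.pi ^ 2 * δ / 2)), by positivity, L, fun β hβ j bc f hf => ?_⟩
  have hβ0 : 0 < β := lt_of_lt_of_le one_pos ((le_max_left _ _).trans hβ)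
  obtain ⟨f₀, φ, hf₀, hφ, hsum⟩ := hL j bc f.cell hf
  refine le_trans ?_ (le_tildeM hβ0 hε0 f f₀ hf₀ φ hφ)
  have h1 := (le_max_right _ _).trans hβ
  rw [div_le_iff₀ (by positivity)] at h1
  have h2 : Real.exp (-(Real.pi ^ 2 * β * (δ / 2))) ≤ c := by
    rw [← Real.le_log_iff_exp_le hc0]
    linarith
  calc Real.exp (-(Real.pi ^ 2 * β * (1 + δ)))
      = Real.exp (-(β / 2) * (2 * Real.pi ^ 2 * (1 + δ / 4)) - β * ε) *
          Real.exp (-(Real.pi ^ 2 * β * (δ / 2))) := by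
        rw [← Real.exp_add, hε]; congr 1; ring
    _ ≤ _ := by
        refine mul_le_mul (Real.exp_le_exp.2 ?_) h2 (Real.exp_pos _).le (Real.exp_pos _).le
        have := mul_le_mul_of_nonneg_left hsum (half_pos hβ0).le
        linarith

/-! ### Passage to the lower limits -/

lemma eventually_farFromBoundary {n k : ℕ} (w : Cell n k) (L : ℕ) :
    ∀ᶠ j : ℕ in atTop, w.FarFromBoundary j L := by
  refine eventually_all.2 fun i => ?_
  filter_upwards [eventually_ge_atTop (L + (w.base i).natAbs + 1)] with j hj
  split_ifs <;> omega

lemma le_inv_mul_log_of_exp_le {β t M : ℝ} (hβ : 0 < β) (h : Real.exp (β * t) ≤ M) :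
    (t : EReal) ≤ ((1 / β : ℝ) : EReal) * ENNReal.log (ENNReal.ofReal M) := by
  have h1 : ((β * t : ℝ) : EReal) ≤ ENNReal.log (ENNReal.ofReal M) := by
    refine le_trans (le_of_eq ?_) (ENNReal.log_monotone (ENNReal.ofReal_le_ofReal h))
    rw [ENNReal.log_ofReal_of_pos (Real.exp_pos _), Real.log_exp]
  have h2 : (t : EReal) = ((1 / β : ℝ) : EReal) * ((β * t : ℝ) : EReal) := by
    rw [← EReal.coe_mul]; congr 1; field_simp
  rw [h2]
  exact mul_le_mul_of_nonneg_left h1 (by exact_mod_cast (one_div_pos.2 hβ).le)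

end VillainGauge

end

theorem propositionp :
    (∀ δ : ℝ, 0 < δ → ∃ β₀ : ℝ, ∀ β : ℝ, β₀ ≤ β → ∃ L₀ : ℕ, ∀ j : ℕ, L₀ ≤ j →
      ∀ (bc : VillainGauge.BC) (f : VillainGauge.OrientedCell 4 2),
        f.cell.FarFromBoundary j L₀ →
          Real.exp (-(Real.pi ^ 2 * β * (1 + δ))) ≤ VillainGauge.tildeM bc j β f) ∧
    (∀ (bc : VillainGauge.BC) (f : VillainGauge.OrientedCell 4 2),
      ((-(Real.pi ^ 2) : ℝ) : EReal) ≤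
        liminf (fun β : ℝ => liminf (fun j : ℕ =>
          ((1 / β : ℝ) : EReal) *
            ENNReal.log (ENNReal.ofReal (VillainGauge.tildeM bc j β f))) atTop) atTop) := by
  refine ⟨fun δ hδ => ?_, fun bc f => ?_⟩
  · obtain ⟨β₀, -, L, h⟩ := VillainGauge.exists_exp_le_tildeM hδ
    exact ⟨β₀, fun β hβ => ⟨L, fun j _ bc f hf => h β hβ j bc f hf⟩⟩
  · have hlim : Tendsto (fun δ : ℝ => ((-(Real.pi ^ 2 * (1 + δ)) : ℝ) : EReal))
        (nhdsWithin 0 (Set.Ioi 0)) (nhds ((-(Real.pi ^ 2) : ℝ) : EReal)) := by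
      have hc : Continuous fun δ : ℝ => ((-(Real.pi ^ 2 * (1 + δ)) : ℝ) : EReal) :=
        continuous_coe_real_ereal.comp (by fun_prop)
      have := hc.tendsto 0
      simp only [add_zero, mul_one] at this
      exact this.mono_left nhdsWithin_le_nhds
    -- It suffices to bound the lower limit below by -π²(1 + δ) for each δ > 0. The margin L depends
    -- on δ alone, so a fixed face is eventually far enough from the boundary as j grows.
    refine le_of_tendsto hlim ?_
    filter_upwards [self_mem_nhdsWithin] with δ hδ
    obtain ⟨β₀, hβ₀, L, h⟩ := VillainGauge.exists_exp_le_tildeM hδ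
    refine le_liminf_of_le (by isBoundedDefault) ?_
    filter_upwards [eventually_ge_atTop β₀] with β hβ
    refine le_liminf_of_le (by isBoundedDefault) ?_
    filter_upwards [VillainGauge.eventually_farFromBoundary f.cell L] with j hj
    refine VillainGauge.le_inv_mul_log_of_exp_le (hβ₀.trans_le hβ) ?_
    refine le_trans (le_of_eq ?_) (h β hβ j bc f hj)
    congr 1
    ring
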